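/- **Conventions.** Fix an infinite universe $\mathcal U$ containing three distinct elements $\mathit{true},\mathit{false},\mathit{undef}$, and a vocabulary of function symbols with arities, some of which are declared to be background symbols. A *structure* has a base set $B\subseteq\mathcal U$ with $\mathit{true},\mathit{false},\mathit{undef}\in B$ and interprets each symbol $f$ of arity $n$ by a function $B^n\to B$; isomorphisms fix $\mathit{true},\mathit{false},\mathit{undef}$. Terms are built from function symbols, the three constants, equality and the Boolean connectives. A location is a pair $\ell=(f,\bar a)$, an update a pair $(\ell,v)$; for structures $S,S'$ with the same base set, $\Delta(S,S')$ is the least update set leading from $S$ to $S'$. **Components and calls.** A finite family of components $i\in I$, one of which is *main*, is considered. Component $i$ has a finite signature $\Sigma^i$ of non-background symbols, the disjoint union of input, local and output symbols $\Sigma^i_{in},\Sigma^i_{loc},\Sigma^i_{out}$. A *call* consists of a callee $c\in I$ and an assignment that gives, for each $f\in\Sigma^c_{in}$, either a value (only if $f$ is nullary) or a function $g(\bar v,\cdot)$ of the caller, and for each $f\in\Sigma^c_{out}$ a function $g(\bar v,\cdot)$ of the caller (a location of the caller, if $f$ is nullary). During the run of the callee, $f$ is identified with that function of the caller. **Sequential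 recursive algorithms.** A sequential recursive algorithm $\mathcal R$ consists, for each component $i$, of a set $\mathcal S_i$ of states, a set $\mathcal I_i\subseteq\mathcal S_i$ of initial states, a relation $\tau_i(S,K,S')$ ("from $S\in\mathcal S_i$ a step leads to $S'\in\mathcal S_i$ and makes the finite multiset $K$ of calls"), and a finite set $W_i$ of ground terms over $\Sigma^i$ and the background, such that: 1. (*Abstract state*) States are structures over $\Sigma^i$ and the background; $\mathcal S_i$, $\mathcal I_i$ and $\tau_i$ are closed under isomorphisms; steps change neither the base set nor the background functions. 2. (*Bounded exploration*) If $S_1,S_2\in\mathcal S_i$ give the same values to all terms in $W_i$, then the sets $\{(\Delta(S_j,S'),K)\mid \tau_i(S_j,K,S')\}$ are equal for $j=1,2$. 3. (*Input/output assumption*) Steps of $i$ never update input symbols of $i$; no output symbol of $i$ occurs in $W_i$; in initial states all local and output locations have the value $\mathit{undef}$. 4. (*Call steps*) Let $\tau_i(S,K,S')$ hold. The values in the calls in $K$ are in the base set of $S$, and each call uses symbols of the caller's signature with fitting arities. Caller symbols shared as input of a callee do not occur in $W_i$. Caller symbols shared as output of a callee are never updated by steps of $i$, are not input symbols of $i$,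 and differ from each other and from those shared as input of the same callee. Output locations of one call in $K$ are not input or output locations of another call in $K$. For each call in $K$, the structure in which base set and background are those of $S'$, input and output symbols of the callee are interpreted in $S'$ as the call prescribes, and all local functions are undefined, is an initial state of the callee. 5. (*Bounded call tree branching*) There is $m>0$ such that in recursive runs every step of an instance makes at most $m$ calls. **Recursive runs.** A global state consists of finitely many called instances of components, each with its own local state and, except for the first instance, a caller and the call that created it. A local state of component $i$ is *final* if no step from it changes it or makes a call. An instance is *terminated* if its local state is final and all instances called by it are terminated; it is *active* if it is called and not terminated, and *waiting* if some instance called by it is active. A *recursive run* is a finite or infinite sequence $S_0,S_1,\dots$ of global states, in which all local states are states of their components, with finite sets $C_0,C_1,\dots$ of instances such that: in $S_0$ there is just one instance, of *main*, in an initial state of *main*, and $C_0$ contains just this instance; all elements of $C_j$ are active and not waiting in $S_j$; $S_{j+1}$ results from $S_j$ by simultaneously performing one step of each instance in $C_j$, where updates of shared locations take effect for all instances sharing them, and for each call a fresh instance of the callee is created, in an initial state determined as in 4. Functions are shared between caller and callee as long as the callee is active. **Recursive ASMs.** Rules are assignments $f(t_1,\dots,t_n):=t_0$, IF $\varphi$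 THEN $r$ (with a Boolean term $\varphi$), bounded parallel composition (including the empty one), bounded choice between finitely many rules, LET $x=t$ IN $r$, and call rules, which consist of a callee (named by its component), for each of its input symbols a term (passed by value, only for nullary symbols) or a function $g(\bar t,\cdot)$ of the caller, and for each of its output symbols a function $g(\bar t,\cdot)$ of the caller; the outermost symbol of a term passed by value is different from the symbols $g$ for the output. A rule yields in each state, in the usual way, a set of update sets, each together with a multiset of calls. A *recursive ASM* consists, for each component $i$, of a rule over $\Sigma^i$ and the background without free variables, a class of states closed under isomorphisms and under the steps of the rule, and a class of initial states closed under isomorphisms and contained in it, such that the conditions in 3 and 4 hold for the steps $S\mapsto S+\Delta$ (for consistent update sets $\Delta$ yielded by the rule in a state $S$), with the symbols read by the rule in place of the symbols occurring in $W_i$; and of a main component. Its recursive runs are defined as above, with these steps. **Theorem.** For every sequential recursive algorithm $\mathcal R$ there is a recursive ASM $\mathcal M$ (with the same components and signatures) which is equivalent to $\mathcal R$ with respect to recursive runs: $\mathcal M$ and $\mathcal R$ have the same main component, the same states and initial states, and exactly the same recursive runs. -/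

import Mathlib

namespace RecursiveASM

/-! ### Vocabulary, terms, structures -/

/-- The three logical elements that belong to every base set. -/
class LogicalConstants (U : Type*) where
  tt : U
  ff : U
  undef : U
  tt_ne_ff : tt ≠ ff
  tt_ne_undef : tt ≠ undef
  ff_ne_undef : ff ≠ undef

/-- A stock of function symbols with arities. The symbols in `bg` are the (non-logical) operations
of the background: they are static and have the same meaning for all algorithms. -/
structure Vocabulary where
  Sym : Type*
  arity : Sym → ℕ
  bg : Set Sym

/-- The finite signature of an i/o-algorithm, split into input, local and output symbols. -/
structure IOSig (V : Vocabulary) where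
  inp : Finset V.Sym
  loc : Finset V.Sym
  out : Finset V.Sym
  disj_inp_loc : Disjoint inp loc
  disj_inp_out : Disjoint inp out
  disj_loc_out : Disjoint loc out
  not_bg : ∀ f, f ∈ inp ∨ f ∈ loc ∨ f ∈ out → f ∉ V.bg

/-- All symbols of the signature. -/
def IOSig.syms {V : Vocabulary} (s : IOSig V) : Set V.Sym :=
  {f | f ∈ s.inp ∨ f ∈ s.loc ∨ f ∈ s.out}

/-- Terms with `n` free variables; ground terms are the terms with `n = 0`. The truth values,
`undef`, equality and the connectives are always available. -/
inductive Term (V : Vocabulary) (n : ℕ) where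
  | var (x : Fin n) : Term V n
  | app (f : V.Sym) (ts : Fin (V.arity f) → Term V n) : Term V n
  | tt : Term V n
  | ff : Term V n
  | undef : Term V n
  | eq (s t : Term V n) : Term V n
  | not (s : Term V n) : Term V n
  | and (s t : Term V n) : Term V n

/-- The function symbols occurring in a term (at any depth). -/
def Term.syms {V : Vocabulary} {n : ℕ} : Term V n → Set V.Sym
  | .var _ => ∅
  | .app f ts => {f} ∪ ⋃ i, (ts i).syms
  | .tt => ∅
  | .ff => ∅
  | .undef => ∅
  | .eq s t => s.syms ∪ t.syms
  | .not s => s.syms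
  | .and s t => s.syms ∪ t.syms

/-- Boolean terms: equations and the truth values, closed under the connectives. -/
def Term.IsBoolean {V : Vocabulary} {n : ℕ} : Term V n → Prop
  | .var _ => False
  | .app _ _ => False
  | .tt => True
  | .ff => True
  | .undef => False
  | .eq _ _ => True
  | .not s => s.IsBoolean
  | .and s t => s.IsBoolean ∧ t.IsBoolean

/-- `f` is the outermost function symbol of the term. -/
def Term.HasHead {V : Vocabulary} {n : ℕ} (f : V.Sym) : Term V n → Prop
  | .app g _ => g = f
  | _ => False

/-- The term is built over the given signature and the background. -/
def Term.Over {V : Vocabulary} {n : ℕ} (s : IOSig V) (t : Term V n) : Prop :=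
  ∀ f ∈ t.syms, f ∈ s.syms ∨ f ∈ V.bg

/-- A structure whose base set is a subset of the universe `U`. The interpretation of a symbol is
a total function on lists, normalised to `undef` outside of `baseᵃʳⁱᵗʸ`, so that two structures are
equal iff they have the same base set and the same functions on it. -/
@[ext]
structure State (V : Vocabulary) (U : Type*) [LogicalConstants U] where
  base : Set U
  fn : V.Sym → List U → U
  tt_mem : LogicalConstants.tt ∈ base
  ff_mem : LogicalConstants.ff ∈ base
  undef_mem : LogicalConstants.undef ∈ base
  fn_mem : ∀ f a, fn f a ∈ base
  fn_undef : ∀ f a, (a.length ≠ V.arity f ∨ ∃ x ∈ a, x ∉ base) → fn f a = LogicalConstants.undef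

section
variable {V : Vocabulary} {U : Type*} [LogicalConstants U]

/-- `S` is a structure over the given signature (and the background): all other symbols of the
vocabulary are uninterpreted. -/
def State.Over (S : State V U) (s : IOSig V) : Prop :=
  ∀ f, f ∉ s.syms → f ∉ V.bg → ∀ a, S.fn f a = LogicalConstants.undef

open scoped Classical in
/-- The value of a term in a state, under an assignment of values to its variables. -/
noncomputable def Term.val (S : State V U) {n : ℕ} (ρ : Fin n → U) : Term V n → U
  | .var x => ρ x
  | .app f ts => S.fn f (List.ofFn fun i => (ts i).val S ρ)
  | .tt => LogicalConstants.tt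
  | .ff => LogicalConstants.ff
  | .undef => LogicalConstants.undef
  | .eq s t => if s.val S ρ = t.val S ρ then LogicalConstants.tt else LogicalConstants.ff
  | .not s =>
      if s.val S ρ = LogicalConstants.tt then LogicalConstants.ff
      else if s.val S ρ = LogicalConstants.ff then LogicalConstants.tt
      else LogicalConstants.undef
  | .and s t =>
      if s.val S ρ = LogicalConstants.tt ∧ t.val S ρ = LogicalConstants.tt then LogicalConstants.tt
      else if (s.val S ρ = LogicalConstants.tt ∨ s.val S ρ = LogicalConstants.ff) ∧
          (t.val S ρ = LogicalConstants.tt ∨ t.val S ρ = LogicalConstants.ff)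
        then LogicalConstants.ff
      else LogicalConstants.undef

/-- The value of a ground term. -/
noncomputable def Term.gval (S : State V U) (t : Term V 0) : U := t.val S Fin.elim0

/-- `σ` (restricted to the base set of `S`) is an isomorphism from `S` onto `T`. -/
structure IsIso (σ : U → U) (S T : State V U) : Prop where
  bij : Set.BijOn σ S.base T.base
  map_tt : σ LogicalConstants.tt = LogicalConstants.tt
  map_ff : σ LogicalConstants.ff = LogicalConstants.ff
  map_undef : σ LogicalConstants.undef = LogicalConstants.undef
  map_fn : ∀ f a, (∀ x ∈ a, x ∈ S.base) → σ (S.fn f a) = T.fn f (a.map σ)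

/-- A location: a function symbol with a tuple of arguments. -/
abbrev Location (V : Vocabulary) (U : Type*) := V.Sym × List U

/-- An update: a location with a new value. -/
abbrev Update (V : Vocabulary) (U : Type*) := Location V U × U

/-- The value of a location. -/
def State.at (S : State V U) (l : Location V U) : U := S.fn l.1 l.2

/-- The difference `Δ(S, S')`: the least update set leading from `S` to `S'`. -/
def State.diff (S S' : State V U) : Set (Update V U) :=
  {u | S'.at u.1 = u.2 ∧ S.at u.1 ≠ u.2}

/-- `S' = S + Δ`. No such `S'` exists if `Δ` is inconsistent. -/
def State.Applies (S : State V U) (Δ : Set (Update V U)) (S' : State V U) : Prop :=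
  S'.base = S.base ∧ (∀ u ∈ Δ, S'.at u.1 = u.2) ∧
    ∀ l, (∀ v, (l, v) ∉ Δ) → S'.at l = S.at l

end

/-! ### Calls -/

/-- A reference to the function `x ↦ sym (pre, x)` of the caller; it is a location of the caller if
`pre` fills all argument places, and a function of the caller if `pre` is empty. The entries of
`pre` are values in a call and terms in a call rule. -/
structure Ref (V : Vocabulary) (X : Type*) where
  sym : V.Sym
  pre : List X

/-- What is passed for an input symbol of a callee: a value (for a nullary symbol, i.e. for an input
parameter), or a function of the caller with which the input function is identified. -/
inductive Actual (V : Vocabulary) (X : Type*) where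
  | value (x : X) : Actual V X
  | ref (r : Ref V X) : Actual V X

/-- A call: the callee, what is passed for its input symbols, and the functions (or locations) of
the caller with which its output symbols are identified. -/
structure Call {V : Vocabulary} {ι : Type*} (sig : ι → IOSig V) (X : Type*) where
  callee : ι
  input : {f // f ∈ (sig callee).inp} → Actual V X
  output : {f // f ∈ (sig callee).out} → Ref V X

section
variable {V : Vocabulary} {ι : Type*} {sig : ι → IOSig V} {X Y : Type*}

def Ref.map (h : X → Y) (r : Ref V X) : Ref V Y := ⟨r.sym, r.pre.map h⟩

def Actual.map (h : X → Y) : Actual V X → Actual V Y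
  | .value x => .value (h x)
  | .ref r => .ref (r.map h)

def Call.map (h : X → Y) (k : Call sig X) : Call sig Y where
  callee := k.callee
  input f := (k.input f).map h
  output f := (k.output f).map h

/-- The call identifies the input or output symbol `f` of its callee with the reference `r`. -/
def Call.Binds (k : Call sig X) (f : V.Sym) (r : Ref V X) : Prop :=
  (∃ hf : f ∈ (sig k.callee).inp, k.input ⟨f, hf⟩ = .ref r) ∨
    ∃ hf : f ∈ (sig k.callee).out, k.output ⟨f, hf⟩ = r

/-- The values, or terms, occurring in a call. -/
def Call.items (k : Call sig X) : Set X :=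
  {x | (∃ f, k.input f = .value x) ∨ (∃ f r, k.input f = .ref r ∧ x ∈ r.pre) ∨
    ∃ f, x ∈ (k.output f).pre}

/-- The call is well-formed for a caller with signature `s`: values are passed for nullary symbols
only; the symbols that are referred to belong to the caller, have fitting arities, and those for
the output are not input symbols of the caller and are different from each other and from those for
the input. -/
structure Call.WellFormed (s : IOSig V) (k : Call sig X) : Prop where
  value_nullary : ∀ f x, k.input f = .value x → V.arity f = 0
  sym_mem : ∀ f r, k.Binds f r → r.sym ∈ s.syms
  arity_eq : ∀ f r, k.Binds f r → r.pre.length + V.arity f = V.arity r.sym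
  output_not_inp : ∀ f, (k.output f).sym ∉ s.inp
  output_distinct : ∀ f (g : V.Sym) r, k.Binds g r → g ≠ f.1 → r.sym ≠ (k.output f).sym

/-- The locations of the caller that a reference for a symbol of arity `n` stands for. -/
def Ref.locations (r : Ref V X) (n : ℕ) : Set (Location V X) :=
  {l | ∃ a : List X, a.length = n ∧ l = (r.sym, r.pre ++ a)}

/-- No output location of the call `k₁` is an input or output location of the call `k₂`. -/
def Call.OutputsApart (k₁ k₂ : Call sig X) : Prop :=
  ∀ f (g : V.Sym) r, k₂.Binds g r →
    Disjoint ((k₁.output f).locations (V.arity f)) (r.locations (V.arity g))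

end

/-! ### Systems of components -/

/-- A finite family of interacting components (the index type `ι` will be finite): each has a
signature, states, initial states and a one-step transition relation `step i S K S'`, where `K` is
the multiset of calls made in the step (empty, if the step is not a call step). -/
structure System {V : Vocabulary} {ι : Type*} (sig : ι → IOSig V) (U : Type*)
    [LogicalConstants U] where
  main : ι
  states : ι → Set (State V U)
  init : ι → Set (State V U)
  step : ι → State V U → Multiset (Call sig U) → State V U → Prop

section
variable {V : Vocabulary} {ι : Type*} {sig : ι → IOSig V} {U : Type*} [LogicalConstants U]

/-- `T` is the local state in which an instance called by `k` starts if `P` is the state of its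
caller: base set and background are those of the caller, input and output symbols are interpreted
as the call prescribes, all other symbols are undefined. -/
structure ChildState (P : State V U) (k : Call sig U) (T : State V U) : Prop where
  base_eq : T.base = P.base
  background : ∀ f ∈ V.bg, ∀ a, T.fn f a = P.fn f a
  undefined : ∀ f, f ∉ V.bg → f ∉ (sig k.callee).inp → f ∉ (sig k.callee).out →
    ∀ a, T.fn f a = LogicalConstants.undef
  value : ∀ f v, k.input f = .value v → T.fn f [] = v
  shared : ∀ f r, k.Binds f r → ∀ a : List U, a.length = V.arity f →
    T.fn f a = P.fn r.sym (r.pre ++ a)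

namespace System
variable (A : System sig U)

/-- Branching time. -/
structure BranchingTime : Prop where
  init_sub : ∀ i, A.init i ⊆ A.states i
  step_sub : ∀ i S K S', A.step i S K S' → S ∈ A.states i ∧ S' ∈ A.states i

/-- Abstract state. The operations of the background are static. -/
structure AbstractState : Prop where
  states_over : ∀ i, ∀ S ∈ A.states i, S.Over (sig i)
  states_iso : ∀ i σ S T, S ∈ A.states i → IsIso σ S T → T ∈ A.states i
  init_iso : ∀ i σ S T, S ∈ A.init i → IsIso σ S T → T ∈ A.init i
  base_eq : ∀ i S K S', A.step i S K S' → S'.base = S.base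
  bg_static : ∀ i S K S', A.step i S K S' → ∀ f ∈ V.bg, ∀ a, S'.fn f a = S.fn f a
  step_iso : ∀ i σ S K S' T T', A.step i S K S' → IsIso σ S T → IsIso σ S' T' →
    A.step i T (K.map (Call.map σ)) T'

/-- The update sets, together with the calls, of the steps of component `i` in the state `S`. -/
def deltas (i : ι) (S : State V U) : Set (Set (Update V U) × Multiset (Call sig U)) :=
  {d | ∃ S', A.step i S d.2 S' ∧ d.1 = S.diff S'}

/-- Bounded exploration, with the finite sets `W i` of ground terms as witnesses. -/
structure BoundedExploration (W : ι → Finset (Term V 0)) : Prop where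
  terms_over : ∀ i, ∀ t ∈ W i, t.Over (sig i)
  deltas_eq : ∀ i, ∀ S ∈ A.states i, ∀ T ∈ A.states i,
    (∀ t ∈ W i, t.gval S = t.gval T) → A.deltas i S = A.deltas i T

/-- In some step of component `i` a location with symbol `f` is updated. -/
def Updates (i : ι) (f : V.Sym) : Prop :=
  ∃ S K S' a v, A.step i S K S' ∧ ((f, a), v) ∈ S.diff S'

/-- The input/output assumption, where `reads i` is the set of symbols read by component `i`. -/
structure IOAssumption (reads : ι → Set V.Sym) : Prop where
  inp_not_updated : ∀ i, ∀ f ∈ (sig i).inp, ¬ A.Updates i f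
  out_not_read : ∀ i, ∀ f ∈ (sig i).out, f ∉ reads i
  init_undef : ∀ i, ∀ S ∈ A.init i, ∀ f, f ∈ (sig i).loc ∨ f ∈ (sig i).out →
    ∀ a, S.fn f a = LogicalConstants.undef

/-- The call relationship between component `i` as caller and the callee of `k`: the functions of
the caller that are shared as input of the callee are not read by the caller, those that are shared
as output of the callee are not updated by it. (Local functions are never shared, because every
instance has its own copy of them.) -/
structure CallRelationship (reads : ι → Set V.Sym) (i : ι) (k : Call sig U) : Prop where
  wellFormed : k.WellFormed (sig i)
  inp_not_read : ∀ f r, k.input f = .ref r → r.sym ∉ reads i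
  out_not_updated : ∀ f, ¬ A.Updates i (k.output f).sym

/-- Call steps: the call relationship holds between the caller and each callee, the calls made in
one step do not interfere, and in the state `S'` reached by the caller each callee is initialised,
i.e. its local state is one of its initial states. -/
structure CallStep (reads : ι → Set V.Sym) : Prop where
  relationship : ∀ i S K S', A.step i S K S' → ∀ k ∈ K, A.CallRelationship reads i k
  items_mem : ∀ i S K S', A.step i S K S' → ∀ k ∈ K, k.items ⊆ S.base
  independent : ∀ i S K S', A.step i S K S' → ∀ k₁ k₂ : Call sig U,
    ({k₁, k₂} : Multiset (Call sig U)) ≤ K → k₁.OutputsApart k₂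
  initialized : ∀ i S K S', A.step i S K S' → ∀ k ∈ K,
    ∃ T, ChildState S' k T ∧ T ∈ A.init k.callee

/-- A final state: no step changes it, and no step makes a call. -/
def Final (i : ι) (S : State V U) : Prop :=
  ∀ K S', A.step i S K S' → K = 0 ∧ S' = S

end System

/-! ### Recursive runs -/

/-- A global state of a recursive run. Instances of components are labelled by natural numbers.
`called` is the set of (labels of) instances called so far; for each of them there are the component
of which it is an instance, the caller together with the call by which it was created (`none` for
the first instance of `main`), and the local state. For labels outside of `called` the entries are
meaningless. -/
structure Config {V : Vocabulary} {ι : Type*} (sig : ι → IOSig V) (U : Type*)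
    [LogicalConstants U] where
  called : Finset ℕ
  comp : ℕ → ι
  caller : ℕ → Option (ℕ × Call sig U)
  st : ℕ → State V U

namespace Config

/-- `c` is one of the instances called by `p`. -/
def CalledBy (G : Config sig U) (p c : ℕ) : Prop :=
  c ∈ G.called ∧ ∃ k, G.caller c = some (p, k)

/-- An instance has terminated if its local state is final and it is not waiting, i.e. all
instances called by it have terminated. -/
inductive Terminated (A : System sig U) (G : Config sig U) : ℕ → Prop
  | intro (q : ℕ) : A.Final (G.comp q) (G.st q) → (∀ c, G.CalledBy q c → Terminated A G c) →
      Terminated A G q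

def Active (A : System sig U) (G : Config sig U) (q : ℕ) : Prop :=
  q ∈ G.called ∧ ¬ G.Terminated A q

def Waiting (A : System sig U) (G : Config sig U) (p : ℕ) : Prop :=
  ∃ c, G.CalledBy p c ∧ G.Active A c

/-- During the run of a called instance `c`, its input and output functions are shared with its
caller `p` as the call prescribes: the location `x` of the instance `c` is the location `y` of the
instance `p`. -/
def Shares (A : System sig U) (G : Config sig U) (x y : ℕ × Location V U) : Prop :=
  ∃ c p k f r a, c ∈ G.called ∧ G.Active A c ∧ G.caller c = some (p, k) ∧ k.Binds f r ∧
    a.length = V.arity f ∧ x = (c, (f, a)) ∧ y = (p, (r.sym, r.pre ++ a))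

/-- The locations of two instances are the same location of the global state. -/
def SameLoc (A : System sig U) (G : Config sig U) : ℕ × Location V U → ℕ × Location V U → Prop :=
  Relation.EqvGen (G.Shares A)

/-- The multiset of calls by which the instances in `new` were called by `q`. -/
def callsOf (G : Config sig U) (new : Finset ℕ) (q : ℕ) : Multiset (Call sig U) :=
  new.val.filterMap fun c => (G.caller c).bind fun pk => if pk.1 = q then some pk.2 else none

/-- `G'` results from `G` by one recursive step, in which each instance `q` in the finite set `C`
of active and not waiting instances performs one step of its component, from its local state in `G`
to `T q`, with the calls `K q`. -/
structure Step (A : System sig U) (G : Config sig U) (C : Finset ℕ) (T : ℕ → State V U)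
    (K : ℕ → Multiset (Call sig U)) (G' : Config sig U) : Prop where
  active : ∀ q ∈ C, G.Active A q ∧ ¬ G.Waiting A q
  local_step : ∀ q ∈ C, A.step (G.comp q) (G.st q) (K q) (T q)
  called_sub : G.called ⊆ G'.called
  comp_eq : ∀ a ∈ G.called, G'.comp a = G.comp a
  caller_eq : ∀ a ∈ G.called, G'.caller a = G.caller a
  base_eq : ∀ a ∈ G.called, (G'.st a).base = (G.st a).base
  /- The updates of all instances in `C` are applied, wherever the updated location is shared ... -/
  updated : ∀ a ∈ G.called, ∀ l, ∀ q ∈ C, ∀ u ∈ (G.st q).diff (T q),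
    G.SameLoc A (q, u.1) (a, l) → (G'.st a).at l = u.2
  /- ... and nothing else changes. -/
  unchanged : ∀ a ∈ G.called, ∀ l,
    (∀ q ∈ C, ∀ u ∈ (G.st q).diff (T q), ¬ G.SameLoc A (q, u.1) (a, l)) →
      (G'.st a).at l = (G.st a).at l
  /- Each new instance has been called by an instance in `C` and is initialised ... -/
  created : ∀ c ∈ G'.called \ G.called, ∃ q ∈ C, ∃ k, G'.caller c = some (q, k) ∧
    G'.comp c = k.callee ∧ ChildState (G'.st q) k (G'.st c) ∧ G'.st c ∈ A.init k.callee
  /- ... and the new instances are exactly those required by the calls. -/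
  calls_eq : ∀ q ∈ C, G'.callsOf (G'.called \ G.called) q = K q

end Config

/-- A recursive run of length `N ≤ ∞`: global states `G 0, G 1, …` (up to `G N`, if `N` is finite)
and sets `C 0, C 1, …` of instances performing the steps. -/
structure System.IsRun (A : System sig U) (N : ℕ∞) (G : ℕ → Config sig U) (C : ℕ → Finset ℕ) :
    Prop where
  start : ∃ a₀, (G 0).called = {a₀} ∧ (G 0).comp a₀ = A.main ∧ (G 0).caller a₀ = none ∧
    (G 0).st a₀ ∈ A.init A.main ∧ C 0 = {a₀}
  state : ∀ j : ℕ, (j : ℕ∞) ≤ N → ∀ a ∈ (G j).called, (G j).st a ∈ A.states ((G j).comp a)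
  step : ∀ j : ℕ, (j : ℕ∞) < N → ∃ T K, (G j).Step A (C j) T K (G (j + 1))

/-- Bounded call tree branching: in recursive runs at most `m` calls are made by one call step. -/
def System.BoundedBranching (A : System sig U) : Prop :=
  ∃ m : ℕ, 0 < m ∧ ∀ N G C, A.IsRun N G C → ∀ j : ℕ, (j : ℕ∞) < N →
    ∀ T K, (G j).Step A (C j) T K (G (j + 1)) → ∀ q ∈ C j, (K q).card ≤ m

/-- A sequential recursive algorithm. The set of symbols read by a component is the set of symbols
occurring in its bounded exploration witness. -/
structure SeqRecAlgorithm {V : Vocabulary} {ι : Type*} (sig : ι → IOSig V) (U : Type*)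
    [LogicalConstants U] extends System sig U where
  W : ι → Finset (Term V 0)
  branchingTime : toSystem.BranchingTime
  abstractState : toSystem.AbstractState
  boundedExploration : toSystem.BoundedExploration W
  ioAssumption : toSystem.IOAssumption fun i => {f | ∃ t ∈ W i, f ∈ t.syms}
  callStep : toSystem.CallStep fun i => {f | ∃ t ∈ W i, f ∈ t.syms}
  boundedBranching : toSystem.BoundedBranching

end

/-! ### Recursive ASMs -/

/-- Recursive ASM rules with `n` free variables, for components with the signatures `sig`.
`par` and `choose` are binary, `skip` is the empty parallel composition. The components serve as
names of rules; the parameters of a named rule are input and output symbols of its signature. -/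
inductive Rule {V : Vocabulary} {ι : Type*} (sig : ι → IOSig V) : ℕ → Type _
  | skip {n : ℕ} : Rule sig n
  | assign {n : ℕ} (f : V.Sym) (ts : Fin (V.arity f) → Term V n) (t : Term V n) : Rule sig n
  | ifThen {n : ℕ} (φ : Term V n) (r : Rule sig n) : Rule sig n
  | par {n : ℕ} (r s : Rule sig n) : Rule sig n
  | choose {n : ℕ} (r s : Rule sig n) : Rule sig n
  | letIn {n : ℕ} (t : Term V n) (r : Rule sig (n + 1)) : Rule sig n
  | call {n : ℕ} (k : Call sig (Term V n)) : Rule sig n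

section
variable {V : Vocabulary} {ι : Type*} {sig : ι → IOSig V} {U : Type*} [LogicalConstants U]

/-- The rule is well-formed over the signature `s`. -/
def Rule.Over (s : IOSig V) {n : ℕ} : Rule sig n → Prop
  | .skip => True
  | .assign f ts t => f ∈ s.syms ∧ (∀ i, (ts i).Over s) ∧ t.Over s
  | .ifThen φ r => φ.IsBoolean ∧ φ.Over s ∧ r.Over s
  | .par r r' => r.Over s ∧ r'.Over s
  | .choose r r' => r.Over s ∧ r'.Over s
  | .letIn t r => t.Over s ∧ r.Over s
  | .call k => k.WellFormed s ∧ (∀ t ∈ k.items, t.Over s) ∧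
      ∀ f t g, k.input f = .value t → ¬ t.HasHead (k.output g).sym

/-- The function symbols read by a rule. -/
def Rule.reads {n : ℕ} : Rule sig n → Set V.Sym
  | .skip => ∅
  | .assign _ ts t => (⋃ i, (ts i).syms) ∪ t.syms
  | .ifThen φ r => φ.syms ∪ r.reads
  | .par r r' => r.reads ∪ r'.reads
  | .choose r r' => r.reads ∪ r'.reads
  | .letIn t r => t.syms ∪ r.reads
  | .call k => ⋃ t ∈ k.items, t.syms

open scoped Classical in
/-- The set of update sets yielded by a rule in a state, each with the calls that belong to it. -/
noncomputable def Rule.deltas (S : State V U) {n : ℕ} (ρ : Fin n → U) :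
    Rule sig n → Set (Set (Update V U) × Multiset (Call sig U))
  | .skip => {(∅, 0)}
  | .assign f ts t => {({((f, List.ofFn fun i => (ts i).val S ρ), t.val S ρ)}, 0)}
  | .ifThen φ r => if φ.val S ρ = LogicalConstants.tt then r.deltas S ρ else {(∅, 0)}
  | .par r r' => {d | ∃ d₁ ∈ r.deltas S ρ, ∃ d₂ ∈ r'.deltas S ρ, d = (d₁.1 ∪ d₂.1, d₁.2 + d₂.2)}
  | .choose r r' => r.deltas S ρ ∪ r'.deltas S ρ
  | .letIn t r => r.deltas S (Fin.cons (t.val S ρ) ρ : Fin _ → U)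
  | .call k => {(∅, {k.map fun t => t.val S ρ})}

/-- The system of components that is defined by rules, with given classes of states. -/
def ruleSystem (main : ι) (rule : ι → Rule sig 0) (states init : ι → Set (State V U)) :
    System sig U where
  main := main
  states := states
  init := init
  step i S K S' := S ∈ states i ∧ ∃ Δ, (Δ, K) ∈ (rule i).deltas S Fin.elim0 ∧ S.Applies Δ S'

/-- A recursive Abstract State Machine: for each component a rule, a class of states that is closed
under isomorphisms and under steps of the rule, and a class of initial states that is closed under
isomorphisms, such that the input/output assumption and the conditions on call steps are met. -/
structure RecASM {V : Vocabulary} {ι : Type*} (sig : ι → IOSig V) (U : Type*)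
    [LogicalConstants U] where
  main : ι
  rule : ι → Rule sig 0
  states : ι → Set (State V U)
  init : ι → Set (State V U)
  rule_over : ∀ i, (rule i).Over (sig i)
  states_over : ∀ i, ∀ S ∈ states i, S.Over (sig i)
  states_iso : ∀ i σ S T, S ∈ states i → IsIso σ S T → T ∈ states i
  states_step : ∀ i S Δ K S', S ∈ states i → (Δ, K) ∈ (rule i).deltas S Fin.elim0 →
    S.Applies Δ S' → S' ∈ states i
  init_sub : ∀ i, init i ⊆ states i
  init_iso : ∀ i σ S T, S ∈ init i → IsIso σ S T → T ∈ init i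
  ioAssumption : (ruleSystem main rule states init).IOAssumption fun i => (rule i).reads
  callStep : (ruleSystem main rule states init).CallStep fun i => (rule i).reads

/-- The system of components given by a recursive ASM. -/
def RecASM.toSystem (M : RecASM sig U) : System sig U :=
  ruleSystem M.main M.rule M.states M.init

/-- Equivalence with respect to recursive runs: the same states and initial states, and the same
recursive runs. -/
def System.RunEquivalent (A B : System sig U) : Prop :=
  A.main = B.main ∧ A.states = B.states ∧ A.init = B.init ∧
    ∀ N G C, A.IsRun N G C ↔ B.IsRun N G C

end

end RecursiveASM

/-! In a state `S`, a step can only involve the values in `S` of the witness terms and of the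
logical constants (`values_mem_range`): any other element can be renamed away by an isomorphism that
fixes these values, and by bounded exploration the renamed state has the same update sets and calls.
For the same reason, the possible steps depend, up to renaming, only on which of these values
coincide (`deltas_transport`). There are finitely many such patterns. A rule can therefore bind the
values to variables by LET, test the pattern by IF, and choose among update sets and calls written
with variables, provided that finitely many of these belong to each pattern (`exists_rule`).

Only one thing can be infinite here: the multiplicity of calls. With variables for values there are
finitely many updates and well-formed calls, but a call without output symbols may be repeated, and
the bound `m` on the number of calls holds in recursive runs only. The rules are therefore built for
the steps in which every multiset of more than `m` calls is replaced by its set of distinct calls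
(`cap`).

Capping does not change the runs (`Caps.isRun_iff`). In a run of the algorithm there is nothing to
cap. Conversely, let a run of the ASM be a run of the algorithm up to some step, and let this step
come from a step of the algorithm with more calls. Duplicating freshly created instances turns the
resulting global state into one with all these calls, hence into a run of the algorithm; so the
bound `m` applies, and nothing had been capped.

A second discrepancy is harmless. A rule always yields some update set, so the ASM idles where the
algorithm has no step. Such a state is final for both, and an active instance that is not waiting is
never in a final state. -/

namespace RecursiveASM

section
variable {V : Vocabulary} {ι : Type*} {sig : ι → IOSig V} {X Y Z : Type*}

/-! ### Renaming the values in updates and calls -/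

/-- Rename the values in an update. -/
def Update.map (h : X → Y) (u : Update V X) : Update V Y := ((u.1.1, u.1.2.map h), h u.2)

/-- Rename the values in an update set and in the calls that belong to it. -/
def deltaMap (h : X → Y) (d : Set (Update V X) × Multiset (Call sig X)) :
    Set (Update V Y) × Multiset (Call sig Y) :=
  (Update.map h '' d.1, d.2.map (Call.map h))

theorem Ref.map_map (g : Y → Z) (h : X → Y) (r : Ref V X) : (r.map h).map g = r.map (g ∘ h) := by
  simp [Ref.map]

theorem Actual.map_map (g : Y → Z) (h : X → Y) (r : Actual V X) :
    (r.map h).map g = r.map (g ∘ h) := by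
  cases r <;> simp [Actual.map, Ref.map_map]

theorem Call.map_map (g : Y → Z) (h : X → Y) (k : Call sig X) :
    (k.map h).map g = k.map (g ∘ h) := by
  simp [Call.map, Actual.map_map, Ref.map_map]

theorem Update.map_map (g : Y → Z) (h : X → Y) (u : Update V X) :
    Update.map g (Update.map h u) = Update.map (g ∘ h) u := by
  simp [Update.map]

theorem deltaMap_deltaMap (g : Y → Z) (h : X → Y)
    (d : Set (Update V X) × Multiset (Call sig X)) :
    deltaMap g (deltaMap h d) = deltaMap (g ∘ h) d := by
  simp [deltaMap, Set.image_image, Update.map_map, Call.map_map]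

theorem Ref.map_eq_self {h : X → X} {r : Ref V X} (H : ∀ x ∈ r.pre, h x = x) : r.map h = r := by
  cases r
  simp only [Ref.map, Ref.mk.injEq, true_and]
  exact (List.map_congr_left H).trans (by simp)

theorem Call.map_eq_self {h : X → X} {k : Call sig X} (H : ∀ x ∈ k.items, h x = x) :
    k.map h = k := by
  obtain ⟨c, inp, out⟩ := k
  simp only [Call.map, Call.mk.injEq, heq_eq_eq, true_and]
  constructor
  · funext f
    cases hf : inp f with
    | value x => simp only [Actual.map]; rw [H x (Or.inl ⟨f, hf⟩)]
    | ref r =>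
      simp only [Actual.map]
      rw [Ref.map_eq_self fun x hx => H x (Or.inr (Or.inl ⟨f, r, hf, hx⟩))]
  · funext f
    exact Ref.map_eq_self fun x hx => H x (Or.inr (Or.inr ⟨f, hx⟩))

theorem Update.map_eq_self {h : X → X} {u : Update V X} (H : ∀ x ∈ u.1.2, h x = x)
    (H' : h u.2 = u.2) : Update.map h u = u := by
  obtain ⟨⟨f, a⟩, v⟩ := u
  simp only [Update.map, Prod.mk.injEq, true_and]
  exact ⟨(List.map_congr_left H).trans (by simp), H'⟩

theorem Ref.map_injective {h : X → Y} (hh : Function.Injective h) :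
    Function.Injective (Ref.map h : Ref V X → Ref V Y) := by
  rintro ⟨f, a⟩ ⟨g, b⟩ e
  simp only [Ref.map, Ref.mk.injEq] at e
  rw [e.1, hh.list_map e.2]

theorem Actual.map_injective {h : X → Y} (hh : Function.Injective h) :
    Function.Injective (Actual.map h : Actual V X → Actual V Y) := by
  rintro (x | r) (y | s) e <;> simp only [Actual.map, Actual.value.injEq, Actual.ref.injEq,
    reduceCtorEq] at e
  · rw [hh e]
  · rw [Ref.map_injective hh e]

theorem Call.map_injective {h : X → Y} (hh : Function.Injective h) :
    Function.Injective (Call.map h : Call sig X → Call sig Y) := by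
  rintro ⟨c, inp, out⟩ ⟨c', inp', out'⟩ e
  simp only [Call.map, Call.mk.injEq] at e
  obtain ⟨rfl, e₁, e₂⟩ := e
  simp only [heq_eq_eq] at e₁ e₂
  congr 1
  · funext f
    exact Actual.map_injective hh (congrFun e₁ f)
  · funext f
    exact Ref.map_injective hh (congrFun e₂ f)

theorem Call.Binds.map {k : Call sig X} {f : V.Sym} {r : Ref V X} (h : X → Y)
    (H : k.Binds f r) : (k.map h).Binds f (r.map h) := by
  rcases H with ⟨hf, e⟩ | ⟨hf, e⟩
  · exact Or.inl ⟨hf, by simp [Call.map, e, Actual.map]⟩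
  · exact Or.inr ⟨hf, by simp [Call.map, e]⟩

theorem Call.Binds.of_map {k : Call sig X} {f : V.Sym} {h : X → Y} {r : Ref V Y}
    (H : (k.map h).Binds f r) : ∃ r', k.Binds f r' ∧ r'.map h = r := by
  rcases H with ⟨hf, e⟩ | ⟨hf, e⟩
  · cases e' : k.input ⟨f, hf⟩ with
    | value x => simp [Call.map, e', Actual.map] at e
    | ref r' =>
      simp only [Call.map, e', Actual.map, Actual.ref.injEq] at e
      exact ⟨r', Or.inl ⟨hf, e'⟩, e⟩
  · exact ⟨_, Or.inr ⟨hf, rfl⟩, e⟩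

theorem Call.wellFormed_map {s : IOSig V} {k : Call sig X} (h : X → Y) :
    (k.map h).WellFormed s ↔ k.WellFormed s := by
  constructor
  · rintro ⟨h₁, h₂, h₃, h₄, h₅⟩
    refine ⟨fun f x e => h₁ f (h x) (by simp [Call.map, e, Actual.map]),
      fun f r H => h₂ f _ (H.map h), fun f r H => by simpa [Ref.map] using h₃ f _ (H.map h), h₄,
      fun f g r H hg => h₅ f g _ (H.map h) hg⟩
  · rintro ⟨h₁, h₂, h₃, h₄, h₅⟩
    refine ⟨fun f x e => ?_, fun f r H => ?_, fun f r H => ?_, h₄, fun f g r H hg => ?_⟩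
    · cases e' : k.input f with
      | value y => exact h₁ f y e'
      | ref r => simp [Call.map, e', Actual.map] at e
    · obtain ⟨r', H', rfl⟩ := H.of_map
      exact h₂ f r' H'
    · obtain ⟨r', H', rfl⟩ := H.of_map
      simpa [Ref.map] using h₃ f r' H'
    · obtain ⟨r', H', rfl⟩ := H.of_map
      exact h₅ f g r' H' hg

theorem Call.items_map (k : Call sig X) (h : X → Y) : (k.map h).items = h '' k.items := by
  ext y
  constructor
  · rintro (⟨f, e⟩ | ⟨f, r, e, hr⟩ | ⟨f, hr⟩)
    · cases e' : k.input f with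
      | value x =>
        simp only [Call.map, e', Actual.map, Actual.value.injEq] at e
        exact ⟨x, Or.inl ⟨f, e'⟩, e⟩
      | ref r => simp [Call.map, e', Actual.map] at e
    · cases e' : k.input f with
      | value x => simp [Call.map, e', Actual.map] at e
      | ref r' =>
        simp only [Call.map, e', Actual.map, Actual.ref.injEq] at e
        subst e
        obtain ⟨x, hx, rfl⟩ := List.mem_map.1 hr
        exact ⟨x, Or.inr (Or.inl ⟨f, r', e', hx⟩), rfl⟩
    · obtain ⟨x, hx, rfl⟩ := List.mem_map.1 hr
      exact ⟨x, Or.inr (Or.inr ⟨f, hx⟩), rfl⟩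
  · rintro ⟨x, ⟨f, e⟩ | ⟨f, r, e, hr⟩ | ⟨f, hr⟩, rfl⟩
    · exact Or.inl ⟨f, by simp [Call.map, e, Actual.map]⟩
    · exact Or.inr (Or.inl ⟨f, r.map h, by simp [Call.map, e, Actual.map], List.mem_map_of_mem hr⟩)
    · exact Or.inr (Or.inr ⟨f, List.mem_map_of_mem hr⟩)

/-! ### Finiteness -/

theorem IOSig.finite_syms (s : IOSig V) : s.syms.Finite :=
  (s.inp.finite_toSet.union (s.loc.finite_toSet.union s.out.finite_toSet)).subset
    fun f hf => by simpa [IOSig.syms] using hf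

theorem finite_refs [Finite X] (s : IOSig V) :
    {r : Ref V X | r.sym ∈ s.syms ∧ r.pre.length ≤ V.arity r.sym}.Finite := by
  refine (s.finite_syms.biUnion fun f _ =>
    (List.finite_length_le X (V.arity f)).image (Ref.mk f)).subset ?_
  rintro ⟨f, a⟩ ⟨h₁, h₂⟩
  exact Set.mem_biUnion h₁ ⟨a, h₂, rfl⟩

/-- Well-formedness takes the symbols from a finite signature and bounds the argument tuples by
arities. It is applied with variables in the place of values. -/
theorem finite_wellFormed_calls [Finite ι] [Finite X] (s : IOSig V) :
    {k : Call sig X | k.WellFormed s}.Finite := by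
  set A : Set (Actual V X) := Set.range Actual.value ∪ Actual.ref ''
    {r : Ref V X | r.sym ∈ s.syms ∧ r.pre.length ≤ V.arity r.sym} with hA
  have hAf : A.Finite := (Set.finite_range _).union ((finite_refs s).image _)
  refine (Set.finite_iUnion fun c : ι => Set.Finite.image2 (Call.mk c)
    (Set.Finite.pi' fun _ : {f // f ∈ (sig c).inp} => hAf)
    (Set.Finite.pi' fun _ : {f // f ∈ (sig c).out} => finite_refs (X := X) s)).subset ?_
  rintro ⟨c, inp, out⟩ hk
  have href : ∀ f r, (Call.mk c inp out : Call sig X).Binds f r →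
      r.sym ∈ s.syms ∧ r.pre.length ≤ V.arity r.sym := fun f r H =>
    ⟨hk.sym_mem f r H, by have := hk.arity_eq f r H; omega⟩
  refine Set.mem_iUnion.2 ⟨c, inp, fun f => ?_, out, fun f => ?_, rfl⟩
  · cases e : inp f with
    | value x => exact Or.inl ⟨x, rfl⟩
    | ref r => exact Or.inr ⟨r, href f r (Or.inl ⟨f.2, e⟩), rfl⟩
  · exact href f _ (Or.inr ⟨f.2, rfl⟩)

theorem finite_updates [Finite X] (s : IOSig V) :
    {u : Update V X | u.1.1 ∈ s.syms ∧ u.1.2.length = V.arity u.1.1}.Finite := by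
  refine (s.finite_syms.biUnion fun f _ => Set.Finite.image2 (fun a v => ((f, a), v))
    (List.finite_length_eq X (V.arity f)) (Set.finite_univ (α := X))).subset ?_
  rintro ⟨⟨f, a⟩, v⟩ ⟨h₁, h₂⟩
  exact Set.mem_biUnion h₁ ⟨a, h₂, v, trivial, rfl⟩

/-! ### Removing repetitions from large multisets -/

open scoped Classical in
/-- The multiset itself if it has at most `m` elements, else the multiset without repetitions. -/
noncomputable def cap (m : ℕ) (K : Multiset X) : Multiset X :=
  if K.card ≤ m then K else K.dedup

theorem cap_le (m : ℕ) (K : Multiset X) : cap m K ≤ K := by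
  unfold cap; split_ifs
  exacts [le_rfl, @Multiset.dedup_le _ (_) K]

theorem mem_cap {m : ℕ} {K : Multiset X} {x : X} : x ∈ cap m K ↔ x ∈ K := by
  classical
  unfold cap; split_ifs <;> simp

theorem cap_eq_zero {m : ℕ} {K : Multiset X} : cap m K = 0 ↔ K = 0 := by
  simp only [Multiset.eq_zero_iff_forall_notMem, mem_cap]

theorem cap_eq_self {m : ℕ} {K : Multiset X} (h : K.card ≤ m) : cap m K = K := if_pos h

theorem cap_map {m : ℕ} {K : Multiset X} {h : X → Y} (hh : Function.Injective h) :
    cap m (K.map h) = (cap m K).map h := by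
  unfold cap
  rw [Multiset.card_map]
  split_ifs
  · rfl
  · exact @Multiset.dedup_map_of_injective _ _ (_) (_) _ hh K

theorem card_cap_le_or_nodup (m : ℕ) (K : Multiset X) :
    (cap m K).card ≤ m ∨ (cap m K).Nodup := by
  unfold cap; split_ifs with h
  exacts [Or.inl h, Or.inr (@Multiset.nodup_dedup _ (_) K)]

theorem finite_multisets {A : Set X} (hA : A.Finite) (m : ℕ) :
    {K : Multiset X | (∀ x ∈ K, x ∈ A) ∧ (K.card ≤ m ∨ K.Nodup)}.Finite := by
  classical
  -- Multiplicities are at most `m` in the first case and at most 1 in the second; `m + 1` covers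
  -- both, even for `m = 0`.
  refine (((m + 1) • hA.toFinset.val).powerset.toFinset.finite_toSet).subset ?_
  rintro K ⟨h₁, h₂⟩
  simp only [Finset.mem_coe, Multiset.mem_toFinset, Multiset.mem_powerset]
  rw [Multiset.le_iff_count]
  intro x
  by_cases hx : x ∈ K
  · have hc : K.count x ≤ m + 1 := by
      rcases h₂ with h₂ | h₂
      · have := Multiset.count_le_card x K; omega
      · have := Multiset.nodup_iff_count_le_one.1 h₂ x; omega
    have hx' : hA.toFinset.val.count x = 1 :=
      Multiset.count_eq_one_of_mem hA.toFinset.nodup (by simpa using h₁ x hx)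
    simpa [Multiset.count_nsmul, hx'] using hc
  · simp [Multiset.count_eq_zero_of_notMem hx]

/-! ### Injections with prescribed values -/

/-- On the range of `ρ` the map is prescribed. Everything else is embedded into the complement of a
finite set containing `a` and the range of `ρ'`, which is as large as the infinite set `U`. -/
theorem exists_injective_extension {U : Type*} [Infinite U] [Finite X] {ρ ρ' : X → U}
    (h : ∀ x y, ρ x = ρ y ↔ ρ' x = ρ' y) {a : U} (ha : a ∉ Set.range ρ') :
    ∃ σ : U → U, Function.Injective σ ∧ σ ∘ ρ = ρ' ∧ a ∉ Set.range σ := by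
  classical
  have := Fintype.ofFinite X
  obtain ⟨g⟩ : Nonempty (U ↪ ((insert a (Finset.univ.image ρ') : Finset U) : Set U)ᶜ.Elem) := by
    rw [← Cardinal.le_def, Cardinal.mk_compl_finset_of_infinite]
  have hg : ∀ u x, (g u : U) ≠ ρ' x := fun u x e => (g u).2 (by simp [e])
  have hga : ∀ u, (g u : U) ≠ a := fun u e => (g u).2 (by simp [e])
  refine ⟨fun u => if hu : ∃ x, ρ x = u then ρ' hu.choose else g u, fun u v e => ?_,
    funext fun x => ?_, ?_⟩
  · simp only at e
    split_ifs at e with hu hv hv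
    · rw [← h, hu.choose_spec, hv.choose_spec] at e
      exact e
    · exact absurd e.symm (hg _ _)
    · exact absurd e (hg _ _)
    · exact g.injective (Subtype.ext e)
  · have hx : ∃ y, ρ y = ρ x := ⟨x, rfl⟩
    simp only [Function.comp, dif_pos hx]
    exact (h _ _).1 hx.choose_spec
  · rintro ⟨u, hu⟩
    simp only at hu
    split_ifs at hu
    · exact ha ⟨_, hu⟩
    · exact hga _ hu

end

section
variable {V : Vocabulary} {ι : Type*} {sig : ι → IOSig V} {U : Type*} [LogicalConstants U]

/-! ### Isomorphic copies of structures -/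

theorem Term.val_mem (S : State V U) {n : ℕ} {ρ : Fin n → U} (hρ : ∀ i, ρ i ∈ S.base)
    (t : Term V n) : t.val S ρ ∈ S.base := by
  have := S.tt_mem
  have := S.ff_mem
  have := S.undef_mem
  cases t <;> simp only [Term.val]
  · exact hρ _
  · exact S.fn_mem _ _
  all_goals first | assumption | (split_ifs <;> assumption)

open scoped Classical in
theorem IsIso.val {σ : U → U} {S T : State V U} (h : IsIso σ S T) {n : ℕ} {ρ : Fin n → U}
    (hρ : ∀ i, ρ i ∈ S.base) (t : Term V n) : t.val T (σ ∘ ρ) = σ (t.val S ρ) := by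
  have inj : ∀ {x y}, x ∈ S.base → y ∈ S.base → (σ x = σ y ↔ x = y) :=
    fun hx hy => h.bij.injOn.eq_iff hx hy
  have htt : ∀ {x}, x ∈ S.base →
      (σ x = LogicalConstants.tt ↔ x = LogicalConstants.tt) := fun hx => by
    conv_lhs => rw [← h.map_tt]
    exact inj hx S.tt_mem
  have hff : ∀ {x}, x ∈ S.base →
      (σ x = LogicalConstants.ff ↔ x = LogicalConstants.ff) := fun hx => by
    conv_lhs => rw [← h.map_ff]
    exact inj hx S.ff_mem
  induction t with
  | var x => rfl
  | app f ts ih =>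
    simp only [Term.val]
    rw [h.map_fn f _ (by
      intro x hx
      obtain ⟨i, rfl⟩ := (List.mem_ofFn' _ _).1 hx
      exact Term.val_mem S hρ _), List.map_ofFn]
    congr 2
    funext i
    exact ih i
  | tt => exact h.map_tt.symm
  | ff => exact h.map_ff.symm
  | undef => exact h.map_undef.symm
  | eq s t ihs iht =>
    simp only [Term.val, apply_ite σ, h.map_tt, h.map_ff]
    exact if_congr (by rw [ihs, iht, inj (Term.val_mem S hρ s) (Term.val_mem S hρ t)]) rfl rfl
  | not s ihs =>
    simp only [Term.val, apply_ite σ, h.map_tt, h.map_ff, h.map_undef]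
    exact if_congr (by rw [ihs, htt (Term.val_mem S hρ s)]) rfl
      (if_congr (by rw [ihs, hff (Term.val_mem S hρ s)]) rfl rfl)
  | and s t ihs iht =>
    simp only [Term.val, apply_ite σ, h.map_tt, h.map_ff, h.map_undef]
    have hs := Term.val_mem S hρ s
    have ht := Term.val_mem S hρ t
    exact if_congr (by rw [ihs, iht, htt hs, htt ht]) rfl
      (if_congr (by rw [ihs, iht, htt hs, htt ht, hff hs, hff ht]) rfl rfl)

theorem IsIso.gval {σ : U → U} {S T : State V U} (h : IsIso σ S T) (t : Term V 0) :
    t.gval T = σ (t.gval S) := by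
  have := h.val (ρ := Fin.elim0) (fun i => i.elim0) t
  rwa [show σ ∘ Fin.elim0 = Fin.elim0 from funext fun i => i.elim0] at this

open scoped Classical in
theorem State.exists_isIso (S : State V U) {σ : U → U} (hσ : Function.Injective σ)
    (htt : σ LogicalConstants.tt = LogicalConstants.tt)
    (hff : σ LogicalConstants.ff = LogicalConstants.ff)
    (hundef : σ LogicalConstants.undef = LogicalConstants.undef) : ∃ T, IsIso σ S T := by
  have : Nonempty U := ⟨LogicalConstants.tt⟩
  have hinv : ∀ x, Function.invFun σ (σ x) = x := Function.leftInverse_invFun hσ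
  refine ⟨{
    base := σ '' S.base
    fn := fun f a => if ∀ x ∈ a, x ∈ σ '' S.base then σ (S.fn f (a.map (Function.invFun σ)))
      else LogicalConstants.undef
    tt_mem := ⟨_, S.tt_mem, htt⟩
    ff_mem := ⟨_, S.ff_mem, hff⟩
    undef_mem := ⟨_, S.undef_mem, hundef⟩
    fn_mem := fun f a => ?_
    fn_undef := fun f a ha => ?_ }, ⟨?_, htt, hff, hundef, fun f a ha => ?_⟩⟩
  · split_ifs
    exacts [⟨_, S.fn_mem _ _, rfl⟩, ⟨_, S.undef_mem, hundef⟩]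
  · split_ifs with h
    · rcases ha with ha | ⟨x, hx, hx'⟩
      · rw [S.fn_undef f _ (Or.inl (by simpa using ha)), hundef]
      · exact absurd (h x hx) hx'
    · rfl
  · exact ⟨fun x hx => ⟨x, hx, rfl⟩, hσ.injOn, fun _ hx => hx⟩
  · show _ = ite _ _ _
    rw [if_pos]
    · rw [List.map_map, show Function.invFun σ ∘ σ = id from funext hinv, List.map_id]
    · intro x hx
      obtain ⟨y, hy, rfl⟩ := List.mem_map.1 hx
      exact ⟨y, ha y hy, rfl⟩

/-- Outside of the tuples of the right length over the common base set, both structures are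
normalised to `undef`, so they cannot differ there. -/
theorem State.mem_of_mem_diff {S S' : State V U} (hb : S'.base = S.base) {u : Update V U}
    (hu : u ∈ S.diff S') :
    u.1.2.length = V.arity u.1.1 ∧ (∀ x ∈ u.1.2, x ∈ S.base) ∧ u.2 ∈ S.base := by
  obtain ⟨⟨f, a⟩, v⟩ := u
  obtain ⟨h₁, h₂⟩ := hu
  simp only [State.at] at h₁ h₂ ⊢
  subst h₁
  have key : ¬ (a.length ≠ V.arity f ∨ ∃ x ∈ a, x ∉ S.base) := fun h =>
    h₂ ((S.fn_undef f a h).trans (S'.fn_undef f a (hb ▸ h)).symm)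
  push Not at key
  exact ⟨key.1, key.2, hb ▸ S'.fn_mem f a⟩

theorem State.diff_of_isIso {σ : U → U} {S S' T T' : State V U} (h : IsIso σ S T)
    (h' : IsIso σ S' T') (hb : S'.base = S.base) : T.diff T' = Update.map σ '' S.diff S' := by
  have hbT : T'.base = T.base := by rw [← h.bij.image_eq, ← h'.bij.image_eq, hb]
  ext u
  constructor
  · intro hu
    obtain ⟨_, h₁, -⟩ := State.mem_of_mem_diff hbT hu
    obtain ⟨⟨f, a⟩, v⟩ := u
    obtain ⟨b, hb₁, rfl⟩ : ∃ b : List U, (∀ x ∈ b, x ∈ S.base) ∧ b.map σ = a := by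
      have : ∀ x ∈ a, ∃ y, y ∈ S.base ∧ σ y = x := fun x hx => by
        have := h₁ x hx
        rwa [← h.bij.image_eq] at this
      choose! g hg using this
      refine ⟨a.map g, fun x hx => ?_, ?_⟩
      · obtain ⟨y, hy, rfl⟩ := List.mem_map.1 hx
        exact (hg y hy).1
      · rw [List.map_map]
        exact (List.map_congr_left fun x hx => (hg x hx).2).trans (by simp)
    obtain ⟨e₁, e₂⟩ := hu
    simp only [State.at] at e₁ e₂
    rw [← h'.map_fn f b (by rwa [hb])] at e₁
    rw [← h.map_fn f b hb₁, ← e₁] at e₂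
    refine ⟨((f, b), S'.fn f b), ⟨rfl, fun e => e₂ (congrArg σ e)⟩, ?_⟩
    simp [Update.map, e₁]
  · rintro ⟨u, hu, rfl⟩
    obtain ⟨-, h₁, h₂⟩ := State.mem_of_mem_diff hb hu
    obtain ⟨⟨f, a⟩, v⟩ := u
    obtain ⟨e₁, e₂⟩ := hu
    simp only [State.at] at e₁ e₂ h₁ h₂
    refine ⟨?_, ?_⟩
    · simp only [State.at, Update.map]
      rw [← h'.map_fn f a (by rwa [hb]), e₁]
    · simp only [State.at, Update.map]
      rw [← h.map_fn f a h₁]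
      exact fun e => e₂ (h.bij.injOn (S.fn_mem f a) h₂ e)

theorem State.applies_diff_iff {S S' S'' : State V U} (hb : S'.base = S.base) :
    S.Applies (S.diff S') S'' ↔ S'' = S' := by
  constructor
  · rintro ⟨h₁, h₂, h₃⟩
    refine State.ext (h₁.trans hb.symm) (funext fun f => funext fun a => ?_)
    by_cases h : S.at (f, a) = S'.at (f, a)
    · exact (h₃ (f, a) fun v hv => hv.2 (h.trans hv.1)).trans h
    · exact h₂ ((f, a), S'.at (f, a)) ⟨rfl, h⟩
  · rintro rfl
    refine ⟨hb, fun u hu => hu.1, fun l hl => ?_⟩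
    by_contra h
    exact hl _ ⟨rfl, Ne.symm h⟩

theorem State.applies_empty_iff {S S' : State V U} : S.Applies ∅ S' ↔ S' = S := by
  have : S.diff S = ∅ := Set.eq_empty_of_forall_notMem fun u hu => hu.2 hu.1
  rw [← this, State.applies_diff_iff rfl]

end

section
variable {V : Vocabulary} {ι : Type*} {sig : ι → IOSig V} {U : Type*} [LogicalConstants U]

/-! ### Building rules whose terms are variables -/

/-- A parallel composition of assignments and calls. As all terms are variables, the rule reads no
symbol, and terms passed by value have no outermost function symbol; so the restrictions on reading
and on passed values hold trivially. -/
theorem exists_rule_singleton (s : IOSig V) {n : ℕ}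
    {d : Set (Update V (Fin n)) × Multiset (Call sig (Fin n))} (hfin : d.1.Finite)
    (hd : ∀ u ∈ d.1, u.1.1 ∈ s.syms ∧ u.1.2.length = V.arity u.1.1)
    (hk : ∀ k ∈ d.2, k.WellFormed s) :
    ∃ r : Rule sig n, r.Over s ∧ r.reads = ∅ ∧
      ∀ (S : State V U) (ρ : Fin n → U), r.deltas S ρ = {deltaMap ρ d} := by
  obtain ⟨Δ, K⟩ := d
  simp only at hfin hd hk
  induction K using Multiset.induction_on with
  | empty =>
    induction Δ, hfin using Set.Finite.induction_on with
    | empty => exact ⟨.skip, trivial, rfl, fun S ρ => by simp [Rule.deltas, deltaMap]⟩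
    | @insert u Δ hu hΔ ih =>
      obtain ⟨r, h₁, h₂, h₃⟩ := ih fun u hu => hd u (Set.mem_insert_of_mem _ hu)
      obtain ⟨hf, hlen⟩ := hd u (Set.mem_insert _ _)
      obtain ⟨⟨f, a⟩, x⟩ := u
      simp only at hf hlen
      obtain ⟨b, rfl⟩ : ∃ b : Fin (V.arity f) → Fin n, List.ofFn b = a :=
        hlen ▸ ⟨a.get, List.ofFn_get a⟩
      refine ⟨.par (.assign f (fun i => .var (b i)) (.var x)) r,
        ⟨⟨hf, fun i g hg => hg.elim, fun g hg => hg.elim⟩, h₁⟩, ?_, fun S ρ => ?_⟩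
      · simp [Rule.reads, Term.syms, h₂]
      · simp only [Rule.deltas, h₃, Set.mem_singleton_iff, exists_eq_left]
        rw [Set.ofPred_eq_eq_singleton]
        simp [deltaMap, Term.val, Update.map, Set.image_insert_eq, List.map_ofFn,
          Function.comp_def]
  -- Each occurrence of a call gets its own call rule; `par` adds the multisets, so multiplicities
  -- are kept.
  | cons k K ih =>
    obtain ⟨r, h₁, h₂, h₃⟩ := ih fun k hk' => hk k (Multiset.mem_cons_of_mem hk')
    have hitems : (k.map (Term.var (V := V))).items = Term.var '' k.items := Call.items_map k _
    refine ⟨.par (.call (k.map .var)) r, ⟨⟨(Call.wellFormed_map _).2 (hk k (by simp)), ?_, ?_⟩, h₁⟩,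
      ?_, fun S ρ => ?_⟩
    · rw [hitems]
      rintro _ ⟨x, -, rfl⟩ g hg
      exact hg.elim
    · intro f t g e
      cases e' : k.input f with
      | value x =>
        simp only [Call.map, e', Actual.map, Actual.value.injEq] at e
        subst e
        exact id
      | ref r => simp [Call.map, e', Actual.map] at e
    · simp [Rule.reads, hitems, h₂, Term.syms]
    · simp only [Rule.deltas, h₃, Set.mem_singleton_iff, exists_eq_left]
      rw [Set.ofPred_eq_eq_singleton, Call.map_map]
      simp [deltaMap, Term.val, Function.comp_def]

/-- There is no empty choice, which is why an empty `D` has to be represented by an idle rule. -/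
theorem exists_rule_of_finite (s : IOSig V) {n : ℕ}
    {D : Set (Set (Update V (Fin n)) × Multiset (Call sig (Fin n)))} (hD : D.Finite)
    (hd : ∀ d ∈ D, d.1 ⊆ {u | u.1.1 ∈ s.syms ∧ u.1.2.length = V.arity u.1.1})
    (hk : ∀ d ∈ D, ∀ k ∈ d.2, k.WellFormed s) :
    ∃ r : Rule sig n, r.Over s ∧ r.reads = ∅ ∧
      ∀ (S : State V U) (ρ : Fin n → U),
        (D = ∅ → r.deltas S ρ = {(∅, 0)}) ∧ (D ≠ ∅ → r.deltas S ρ = deltaMap ρ '' D) := by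
  have single : ∀ d ∈ D, ∃ r : Rule sig n, r.Over s ∧ r.reads = ∅ ∧
      ∀ (S : State V U) (ρ : Fin n → U), r.deltas S ρ = {deltaMap ρ d} := fun d h =>
    exists_rule_singleton s ((finite_updates s).subset (hd d h)) (hd d h) (hk d h)
  clear hd hk
  induction D, hD using Set.Finite.induction_on with
  | empty => exact ⟨.skip, trivial, rfl, fun S ρ => ⟨fun _ => rfl, fun h => (h rfl).elim⟩⟩
  | @insert d D hd hD ih =>
    obtain ⟨r, h₁, h₂, h₃⟩ := single d (Set.mem_insert _ _)
    obtain ⟨r', h₁', h₂', h₃'⟩ := ih fun d hd => single d (Set.mem_insert_of_mem _ hd)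
    by_cases hE : D = ∅
    · exact ⟨r, h₁, h₂, fun S ρ => ⟨fun h => ((Set.insert_nonempty _ _).ne_empty h).elim,
        fun _ => by simp [h₃, hE]⟩⟩
    · exact ⟨.choose r r', ⟨h₁, h₁'⟩, by simp [Rule.reads, h₂, h₂'], fun S ρ =>
        ⟨fun h => ((Set.insert_nonempty _ _).ne_empty h).elim,
          fun _ => by simp [Rule.deltas, h₃, (h₃' S ρ).2 hE, Set.image_insert_eq]⟩⟩

/-- The pairs of variables that have the same value. -/
def valuePattern {X : Type*} (ρ : X → U) : Set (X × X) := {ij | ρ ij.1 = ρ ij.2}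

theorem exists_pattern_term {n : ℕ} (p : Set (Fin n × Fin n)) :
    ∃ φ : Term V n, φ.IsBoolean ∧ φ.syms = ∅ ∧ ∀ (S : State V U) (ρ : Fin n → U),
      φ.val S ρ = LogicalConstants.tt ↔ valuePattern ρ = p := by
  classical
  have hne := LogicalConstants.tt_ne_ff (U := U)
  suffices H : ∀ Q : Finset (Fin n × Fin n), ∃ φ : Term V n, φ.IsBoolean ∧ φ.syms = ∅ ∧
      ∀ (S : State V U) (ρ : Fin n → U),
        φ.val S ρ = LogicalConstants.tt ↔ ∀ ij ∈ Q, (ρ ij.1 = ρ ij.2 ↔ ij ∈ p) by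
    obtain ⟨φ, h₁, h₂, h₃⟩ := H Finset.univ
    refine ⟨φ, h₁, h₂, fun S ρ => ?_⟩
    rw [h₃, Set.ext_iff]
    simp [valuePattern]
  intro Q
  induction Q using Finset.induction_on with
  | empty => exact ⟨.tt, trivial, rfl, fun S ρ => by simp [Term.val]⟩
  | insert ij Q hij ih =>
    obtain ⟨φ, h₁, h₂, h₃⟩ := ih
    obtain ⟨ψ, h₁', h₂', h₃'⟩ : ∃ ψ : Term V n, ψ.IsBoolean ∧ ψ.syms = ∅ ∧
        ∀ (S : State V U) (ρ : Fin n → U),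
          ψ.val S ρ = LogicalConstants.tt ↔ (ρ ij.1 = ρ ij.2 ↔ ij ∈ p) := by
      by_cases hp : ij ∈ p
      · refine ⟨.eq (.var ij.1) (.var ij.2), trivial, by simp [Term.syms], fun S ρ => ?_⟩
        by_cases e : ρ ij.1 = ρ ij.2 <;> simp [Term.val, hp, hne.symm, e]
      · refine ⟨.not (.eq (.var ij.1) (.var ij.2)), trivial, by simp [Term.syms], fun S ρ => ?_⟩
        by_cases e : ρ ij.1 = ρ ij.2 <;> simp [Term.val, hp, hne.symm, e]
    refine ⟨.and ψ φ, ⟨h₁', h₁⟩, by simp [Term.syms, h₂, h₂'], fun S ρ => ?_⟩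
    rw [Finset.forall_mem_insert, ← h₃ S ρ, ← h₃' S ρ]
    simp only [Term.val]
    split_ifs with h h' <;> simp_all [hne.symm, LogicalConstants.tt_ne_undef.symm]

/-- All guarded rules are put in parallel. Exactly one guard is true, and the others contribute `(∅,
0)`, which is neutral for `par`. -/
theorem exists_rule_by_pattern (s : IOSig V) {n : ℕ} (r : Set (Fin n × Fin n) → Rule sig n)
    (hr : ∀ p, (r p).Over s) (hr' : ∀ p, (r p).reads = ∅) :
    ∃ r' : Rule sig n, r'.Over s ∧ r'.reads = ∅ ∧ ∀ (S : State V U) (ρ : Fin n → U),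
      r'.deltas S ρ = (r (valuePattern ρ)).deltas S ρ := by
  classical
  suffices H : ∀ Q : Finset (Set (Fin n × Fin n)), ∃ r' : Rule sig n, r'.Over s ∧ r'.reads = ∅ ∧
      ∀ (S : State V U) (ρ : Fin n → U), r'.deltas S ρ =
        if valuePattern ρ ∈ Q then (r (valuePattern ρ)).deltas S ρ else {(∅, 0)} by
    have := Fintype.ofFinite (Set (Fin n × Fin n))
    obtain ⟨r', h₁, h₂, h₃⟩ := H Finset.univ
    exact ⟨r', h₁, h₂, fun S ρ => by simp [h₃]⟩
  intro Q
  induction Q using Finset.induction_on with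
  | empty => exact ⟨.skip, trivial, rfl, fun S ρ => by simp [Rule.deltas]⟩
  | insert p Q hp ih =>
    obtain ⟨r', h₁, h₂, h₃⟩ := ih
    obtain ⟨φ, g₁, g₂, g₃⟩ := exists_pattern_term (V := V) (U := U) p
    refine ⟨.par (.ifThen φ (r p)) r', ⟨⟨g₁, fun f hf => by simp [g₂] at hf, hr p⟩, h₁⟩,
      by simp [Rule.reads, g₂, h₂, hr' p], fun S ρ => ?_⟩
    simp only [Rule.deltas, h₃, g₃, Finset.mem_insert]
    by_cases e : valuePattern ρ = p
    · simp only [e, hp, if_true, if_false, true_or, Set.mem_singleton_iff, exists_eq_left]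
      simp
    · simp only [e, if_false, false_or, Set.mem_singleton_iff, exists_eq_left]
      simp

/-! ### Naming the values of ground terms by variables -/

/-- A ground term as a term with free variables. -/
def Term.weaken {n : ℕ} : Term V 0 → Term V n
  | .var x => x.elim0
  | .app f ts => .app f fun i => (ts i).weaken
  | .tt => .tt
  | .ff => .ff
  | .undef => .undef
  | .eq s t => .eq s.weaken t.weaken
  | .not s => .not s.weaken
  | .and s t => .and s.weaken t.weaken

theorem Term.syms_weaken {n : ℕ} (t : Term V 0) : (t.weaken : Term V n).syms = t.syms := by
  induction t with
  | var x => exact x.elim0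
  | _ => simp_all [Term.weaken, Term.syms]

theorem Term.val_weaken (S : State V U) {n : ℕ} (ρ : Fin n → U) (t : Term V 0) :
    t.weaken.val S ρ = t.gval S := by
  unfold Term.gval
  induction t with
  | var x => exact x.elim0
  | eq s t ihs iht => rw [Term.weaken, Term.val, Term.val, ihs, iht]
  | not s ihs => rw [Term.weaken, Term.val, Term.val, ihs]
  | and s t ihs iht => rw [Term.weaken, Term.val, Term.val, ihs, iht]
  | _ => simp_all [Term.weaken, Term.val]

/-- Bind a list of ground terms to variables. -/
def Rule.letAll : (l : List (Term V 0)) → Rule sig l.length → Rule sig 0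
  | [], r => r
  -- The head of the list is bound innermost and LET puts its value in front, so variable `j` names
  -- the `j`-th term.
  | t :: l, r => Rule.letAll l (.letIn t.weaken r)

theorem Rule.over_letAll {s : IOSig V} : (l : List (Term V 0)) → (r : Rule sig l.length) →
    (∀ t ∈ l, t.Over s) → r.Over s → (Rule.letAll l r).Over s
  | [], _, _, hr => hr
  | t :: l, r, hl, hr => by
    refine Rule.over_letAll l _ (fun t ht => hl t (List.mem_cons_of_mem _ ht)) ⟨fun f hf => ?_, hr⟩
    rw [Term.syms_weaken] at hf
    exact hl t List.mem_cons_self f hf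

theorem Rule.reads_letAll : (l : List (Term V 0)) → (r : Rule sig l.length) →
    (Rule.letAll l r).reads = {f | ∃ t ∈ l, f ∈ t.syms} ∪ r.reads
  | [], _ => by simp [Rule.letAll]
  | t :: l, r => by
    rw [Rule.letAll, Rule.reads_letAll l, Rule.reads, Term.syms_weaken]
    ext f
    simp only [List.mem_cons, Set.mem_union, Set.mem_ofPred_eq, exists_eq_or_imp]
    exact or_left_comm.trans or_assoc.symm

/-- The values of a list of ground terms. -/
noncomputable def groundValues (l : List (Term V 0)) (S : State V U) : Fin l.length → U :=
  fun i => (l.get i).gval S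

theorem Rule.deltas_letAll (S : State V U) : (l : List (Term V 0)) → (r : Rule sig l.length) →
    (Rule.letAll l r).deltas S Fin.elim0 = r.deltas S (groundValues l S)
  | [], r => by
    rw [Rule.letAll]
    congr 1
    exact funext fun i => i.elim0
  | t :: l, r => by
    rw [Rule.letAll, Rule.deltas_letAll S l, Rule.deltas, Term.val_weaken]
    congr 1
    funext i
    refine Fin.cases ?_ (fun i => ?_) i <;> rfl

end

section
variable {V : Vocabulary} {ι : Type*} {sig : ι → IOSig V} {U : Type*} [LogicalConstants U]

namespace SeqRecAlgorithm
variable (R : SeqRecAlgorithm sig U)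

/-! ### The update sets of a sequential recursive algorithm -/

/-- The logical constants and the terms of the bounded exploration witness. -/
noncomputable def witnessTerms (i : ι) : List (Term V 0) :=
  .tt :: .ff :: .undef :: (R.W i).toList

theorem gval_eq_of_groundValues_eq {i : ι} {S S' : State V U}
    (h : groundValues (R.witnessTerms i) S = groundValues (R.witnessTerms i) S') :
    ∀ t ∈ R.W i, t.gval S = t.gval S' := by
  intro t ht
  obtain ⟨j, rfl⟩ := List.get_of_mem (show t ∈ R.witnessTerms i by simp [witnessTerms, ht])
  exact congrFun h j

/-- Equal patterns allow an injection that carries the named values of `S` to those of `S'`. The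
isomorphic copy `T` of `S` then agrees with `S'` on the witness, and bounded exploration applies.
The avoided element `a` is needed for `values_mem_range`. -/
theorem deltas_transport [Infinite U] {i : ι} {S S' : State V U} (hS : S ∈ R.states i)
    (hS' : S' ∈ R.states i)
    (h : valuePattern (groundValues (R.witnessTerms i) S) =
      valuePattern (groundValues (R.witnessTerms i) S'))
    {a : U} (ha : a ∉ Set.range (groundValues (R.witnessTerms i) S')) :
    ∃ σ : U → U, σ ∘ groundValues (R.witnessTerms i) S = groundValues (R.witnessTerms i) S' ∧
      a ∉ Set.range σ ∧ Function.Injective σ ∧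
      (∀ d ∈ R.deltas i S, deltaMap σ d ∈ R.deltas i S') ∧
      ∃ T, IsIso σ S T ∧ R.deltas i T = R.deltas i S' := by
  obtain ⟨σ, inj, hσ, haσ⟩ := exists_injective_extension
    (fun x y => iff_of_eq (congrArg (fun p => (x, y) ∈ p) h)) ha
  -- The logical constants head the list of witness terms so that `σ` fixes them, as an isomorphism
  -- must.
  have htt : σ LogicalConstants.tt = LogicalConstants.tt := congrFun hσ ⟨0, by simp [witnessTerms]⟩
  have hff : σ LogicalConstants.ff = LogicalConstants.ff := congrFun hσ ⟨1, by simp [witnessTerms]⟩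
  have hun : σ LogicalConstants.undef = LogicalConstants.undef :=
    congrFun hσ ⟨2, by simp [witnessTerms]⟩
  obtain ⟨T, hT⟩ := S.exists_isIso inj htt hff hun
  have hTS : R.deltas i T = R.deltas i S' := by
    refine R.boundedExploration.deltas_eq i T (R.abstractState.states_iso i σ S T hS hT) S' hS'
      (R.gval_eq_of_groundValues_eq ?_)
    rw [← hσ]
    exact funext fun j => hT.gval _
  refine ⟨σ, hσ, haσ, inj, fun d hd => hTS ▸ ?_, T, hT, hTS⟩
  obtain ⟨S₁, h₁, h₂⟩ := hd
  obtain ⟨T₁, hT₁⟩ := S₁.exists_isIso inj htt hff hun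
  refine ⟨T₁, R.abstractState.step_iso i σ _ _ _ _ _ h₁ hT hT₁, ?_⟩
  rw [State.diff_of_isIso hT hT₁ (R.abstractState.base_eq i _ _ _ h₁), ← h₂]
  rfl

theorem values_mem_range [Infinite U] {i : ι} {S : State V U} (hS : S ∈ R.states i)
    {d : Set (Update V U) × Multiset (Call sig U)} (hd : d ∈ R.deltas i S) :
    (∀ u ∈ d.1, (∀ x ∈ u.1.2, x ∈ Set.range (groundValues (R.witnessTerms i) S)) ∧
      u.2 ∈ Set.range (groundValues (R.witnessTerms i) S)) ∧
    ∀ k ∈ d.2, ∀ x ∈ k.items, x ∈ Set.range (groundValues (R.witnessTerms i) S) := by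
  have key : ∀ a, a ∉ Set.range (groundValues (R.witnessTerms i) S) →
      (∀ u ∈ d.1, a ∉ u.1.2 ∧ a ≠ u.2) ∧ ∀ k ∈ d.2, a ∉ k.items := by
    intro a ha
    -- With `S' = S`: the copy `T` has the same update sets and calls as `S`, but `a` is not in its
    -- base set.
    obtain ⟨σ, -, haσ, -, -, T, hT, hTS⟩ := R.deltas_transport hS hS rfl ha
    have haT : a ∉ T.base := fun h => by
      rw [← hT.bij.image_eq] at h
      exact haσ (Set.image_subset_range _ _ h)
    rw [← hTS] at hd
    obtain ⟨T', h₁, h₂⟩ := hd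
    refine ⟨fun u hu => ?_, fun k hk hx => haT (R.callStep.items_mem i _ _ _ h₁ k hk hx)⟩
    rw [h₂] at hu
    obtain ⟨-, g₁, g₂⟩ := State.mem_of_mem_diff (R.abstractState.base_eq i _ _ _ h₁) hu
    exact ⟨fun h => haT (g₁ a h), fun h => haT (h ▸ g₂)⟩
  refine ⟨fun u hu => ⟨fun x hx => ?_, ?_⟩, fun k hk x hx => ?_⟩
  · by_contra h
    exact ((key x h).1 u hu).1 hx
  · by_contra h
    exact ((key _ h).1 u hu).2 rfl
  · by_contra h
    exact (key x h).2 k hk hx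

theorem sym_mem_of_mem_deltas {i : ι} {S : State V U}
    {d : Set (Update V U) × Multiset (Call sig U)} (hd : d ∈ R.deltas i S) :
    ∀ u ∈ d.1, u.1.1 ∈ (sig i).syms ∧ u.1.2.length = V.arity u.1.1 := by
  obtain ⟨S', h₁, h₂⟩ := hd
  intro u hu
  rw [h₂] at hu
  refine ⟨?_, (State.mem_of_mem_diff (R.abstractState.base_eq i _ _ _ h₁) hu).1⟩
  obtain ⟨e₁, e₂⟩ := hu
  by_contra hf
  apply e₂
  rw [← e₁]
  obtain ⟨hS, hS'⟩ := R.branchingTime.step_sub i _ _ _ h₁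
  by_cases hb : u.1.1 ∈ V.bg
  · exact (R.abstractState.bg_static i _ _ _ h₁ _ hb _).symm
  · exact (R.abstractState.states_over i _ hS _ hf hb _).trans
      (R.abstractState.states_over i _ hS' _ hf hb _).symm

/-- The update sets and (capped) calls, with variables for values, that belong to the steps of
component `i` in the states with the given value pattern. -/
def abstractDeltas (m : ℕ) (i : ι)
    (p : Set (Fin (R.witnessTerms i).length × Fin (R.witnessTerms i).length)) :
    Set (Set (Update V (Fin (R.witnessTerms i).length)) ×
      Multiset (Call sig (Fin (R.witnessTerms i).length))) :=
  {d | d.1 ⊆ {u | u.1.1 ∈ (sig i).syms ∧ u.1.2.length = V.arity u.1.1} ∧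
    (∀ k ∈ d.2, k.WellFormed (sig i)) ∧ (d.2.card ≤ m ∨ d.2.Nodup) ∧
    ∃ S ∈ R.states i, valuePattern (groundValues (R.witnessTerms i) S) = p ∧
      ∃ d₀ ∈ R.deltas i S, deltaMap (groundValues (R.witnessTerms i) S) d = (d₀.1, cap m d₀.2)}

theorem finite_abstractDeltas [Finite ι] (m : ℕ) (i : ι)
    (p : Set (Fin (R.witnessTerms i).length × Fin (R.witnessTerms i).length)) :
    (R.abstractDeltas m i p).Finite :=
  ((finite_updates (sig i)).powerset.prod
    (finite_multisets (finite_wellFormed_calls (sig i)) m)).subset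
    fun _ hd => ⟨hd.1, hd.2.1, hd.2.2.1⟩

/-- An element of `abstractDeltas` may stem from another state with the same pattern and is then
transported to `S`. Conversely, every value in a step of `S` is named by a variable. -/
theorem deltaMap_image_abstractDeltas [Infinite U] (m : ℕ) {i : ι} {S : State V U}
    (hS : S ∈ R.states i) :
    deltaMap (groundValues (R.witnessTerms i) S) ''
        R.abstractDeltas m i (valuePattern (groundValues (R.witnessTerms i) S)) =
      (fun d => (d.1, cap m d.2)) '' R.deltas i S := by
  set ρ := groundValues (R.witnessTerms i) S with hρ
  ext d
  constructor
  · rintro ⟨d, ⟨-, -, -, S₁, hS₁, hp, d₁, hd₁, e⟩, rfl⟩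
    obtain ⟨a, ha⟩ := (Set.finite_range ρ).infinite_compl.nonempty
    obtain ⟨σ, hσ, -, inj, H, -⟩ := R.deltas_transport hS₁ hS hp ha
    refine ⟨_, H d₁ hd₁, ?_⟩
    rw [← hρ] at hσ
    rw [← hσ, ← deltaMap_deltaMap, e]
    simp only [deltaMap, cap_map (Call.map_injective inj)]
  · rintro ⟨d, hd, rfl⟩
    have : Nonempty (Fin (R.witnessTerms i).length) := ⟨⟨0, by simp [witnessTerms]⟩⟩
    -- `g` selects one variable for each named value, even if several variables have that value.
    obtain ⟨g, hg⟩ : ∃ g : U → Fin (R.witnessTerms i).length, ∀ x ∈ Set.range ρ, ρ (g x) = x :=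
      ⟨Function.invFun ρ, fun x hx => Function.invFun_eq hx⟩
    obtain ⟨h₁, h₂⟩ := R.values_mem_range hS hd
    have hback : deltaMap ρ (deltaMap g (d.1, cap m d.2)) = (d.1, cap m d.2) := by
      rw [deltaMap_deltaMap]
      refine Prod.ext ?_ ?_
      · exact (Set.image_congr fun u hu => Update.map_eq_self
          (fun x hx => hg x ((h₁ u hu).1 x hx)) (hg _ (h₁ u hu).2)).trans (Set.image_id _)
      · exact (Multiset.map_congr rfl fun k hk => Call.map_eq_self
          fun x hx => hg x (h₂ k (mem_cap.1 hk) x hx)).trans (Multiset.map_id _)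
    refine ⟨deltaMap g (d.1, cap m d.2), ⟨?_, ?_, ?_, S, hS, rfl, d, hd, hback⟩, hback⟩
    · rintro _ ⟨u, hu, rfl⟩
      simpa [Update.map] using R.sym_mem_of_mem_deltas hd u hu
    · intro k hk
      obtain ⟨k', hk', rfl⟩ := Multiset.mem_map.1 hk
      rw [Call.wellFormed_map]
      obtain ⟨S', hS', -⟩ := hd
      exact (R.callStep.relationship i _ _ _ hS' k' (mem_cap.1 hk')).wellFormed
    · refine (card_cap_le_or_nodup m d.2).imp (fun h => by simpa [deltaMap] using h) fun h => ?_
      exact Multiset.Nodup.of_map (Call.map ρ)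
        ((congrArg (fun d => d.2.Nodup) hback).mpr h)

/-- The rule that describes the steps of a component, with capped calls. -/
theorem exists_rule [Infinite U] [Finite ι] (m : ℕ) (i : ι) :
    ∃ r : Rule sig 0, r.Over (sig i) ∧ r.reads ⊆ {f | ∃ t ∈ R.W i, f ∈ t.syms} ∧
      ∀ S ∈ R.states i, (R.deltas i S = ∅ ∧ r.deltas S Fin.elim0 = {(∅, 0)}) ∨
        r.deltas S Fin.elim0 = (fun d => (d.1, cap m d.2)) '' R.deltas i S := by
  choose r h₁ h₂ h₃ using fun p => exists_rule_of_finite (U := U) (sig i)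
    (R.finite_abstractDeltas m i p) (fun d hd => hd.1) (fun d hd => hd.2.1)
  obtain ⟨r', g₁, g₂, g₃⟩ := exists_rule_by_pattern (U := U) (sig i) r h₁ h₂
  refine ⟨Rule.letAll (R.witnessTerms i) r', Rule.over_letAll _ _ ?_ g₁, ?_, fun S hS => ?_⟩
  · intro t ht
    simp only [witnessTerms, List.mem_cons, Finset.mem_toList] at ht
    rcases ht with rfl | rfl | rfl | ht
    · exact fun f hf => hf.elim
    · exact fun f hf => hf.elim
    · exact fun f hf => hf.elim
    · exact R.boundedExploration.terms_over i t ht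
  · rw [Rule.reads_letAll, g₂, Set.union_empty]
    rintro f ⟨t, ht, hf⟩
    simp only [witnessTerms, List.mem_cons, Finset.mem_toList] at ht
    rcases ht with rfl | rfl | rfl | ht
    · exact hf.elim
    · exact hf.elim
    · exact hf.elim
    · exact ⟨t, ht, hf⟩
  · rw [Rule.deltas_letAll, g₃]
    have e := R.deltaMap_image_abstractDeltas m hS
    obtain ⟨k₁, k₂⟩ := h₃ (valuePattern (groundValues (R.witnessTerms i) S)) S
      (groundValues (R.witnessTerms i) S)
    by_cases hE : R.abstractDeltas m i (valuePattern (groundValues (R.witnessTerms i) S)) = ∅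
    · rw [hE, Set.image_empty] at e
      exact Or.inl ⟨Set.image_eq_empty.1 e.symm, k₁ hE⟩
    · exact Or.inr ((k₂ hE).trans e)

end SeqRecAlgorithm

end

section
variable {V : Vocabulary} {ι : Type*} {sig : ι → IOSig V} {U : Type*} [LogicalConstants U]

/-! ### Systems that differ in the multiplicity of calls only -/

namespace System
variable {A B : System sig U}

/-- The steps of `A` are those of `B` with capped calls, up to idle steps in states where `B` has no
steps. -/
structure Caps (m : ℕ) (A B : System sig U) : Prop where
  main_eq : A.main = B.main
  states_eq : A.states = B.states
  init_eq : A.init = B.init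
  of_step : ∀ i S K S', B.step i S K S' → A.step i S (cap m K) S'
  step_cases : ∀ i S K S', A.step i S K S' →
    (∃ K', B.step i S K' S' ∧ K = cap m K') ∨ (∀ K' S'', ¬ B.step i S K' S'') ∧ K = 0 ∧ S' = S

/-- Capping never empties a nonempty multiset, and the additional idle steps neither change the
state nor make calls. -/
theorem Caps.final_iff {m : ℕ} (h : Caps m A B) (i : ι) (S : State V U) :
    A.Final i S ↔ B.Final i S := by
  constructor
  · intro hA K S' hB
    obtain ⟨h₁, h₂⟩ := hA _ _ (h.of_step i S K S' hB)
    exact ⟨cap_eq_zero.1 h₁, h₂⟩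
  · intro hB K S' hA
    rcases h.step_cases i S K S' hA with ⟨K', h₁, rfl⟩ | ⟨-, h₁, h₂⟩
    · obtain ⟨g₁, g₂⟩ := hB K' S' h₁
      exact ⟨cap_eq_zero.2 g₁, g₂⟩
    · exact ⟨h₁, h₂⟩

end System

/-! ### Recursive steps in systems with the same final states, and duplication of instances -/

namespace Config

theorem Terminated.mono {A B : System sig U} (h : ∀ i S, A.Final i S → B.Final i S)
    {G : Config sig U} {q : ℕ} (hq : G.Terminated A q) : G.Terminated B q := by
  induction hq with
  | intro q hf _ ih => exact .intro q (h _ _ hf) ih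

theorem active_eq {A B : System sig U} (h : ∀ i S, A.Final i S ↔ B.Final i S) (G : Config sig U) :
    G.Active A = G.Active B := by
  funext q
  exact propext (and_congr_right' (not_congr ⟨Terminated.mono fun i S => (h i S).1,
    Terminated.mono fun i S => (h i S).2⟩))

theorem waiting_eq {A B : System sig U} (h : ∀ i S, A.Final i S ↔ B.Final i S) (G : Config sig U) :
    G.Waiting A = G.Waiting B := by
  unfold Waiting
  rw [active_eq h]

theorem sameLoc_eq {A B : System sig U} (h : ∀ i S, A.Final i S ↔ B.Final i S) (G : Config sig U) :
    G.SameLoc A = G.SameLoc B := by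
  have : G.Shares A = G.Shares B := by
    unfold Shares
    rw [active_eq h]
  unfold SameLoc
  rw [this]

/-- This excludes the additional idle steps of the capped system from runs. -/
theorem not_final_of_active {A : System sig U} {G : Config sig U} {q : ℕ} (h : G.Active A q)
    (h' : ¬ G.Waiting A q) : ¬ A.Final (G.comp q) (G.st q) := by
  refine fun hf => h.2 (.intro q hf fun c hc => ?_)
  by_contra hn
  exact h' ⟨c, hc, hc.1, hn⟩

/-- Apart from local steps and initial states, a recursive step depends on the system only through
finality, which determines the active and waiting instances and the sharing of locations. -/
theorem Step.transfer {A B : System sig U} (hfin : ∀ i S, A.Final i S ↔ B.Final i S)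
    (hinit : A.init = B.init) {G G' : Config sig U} {C : Finset ℕ} {T : ℕ → State V U}
    {K : ℕ → Multiset (Call sig U)} (h : G.Step A C T K G')
    (hstep : ∀ q ∈ C, B.step (G.comp q) (G.st q) (K q) (T q)) : G.Step B C T K G' where
  active := by rw [← active_eq hfin, ← waiting_eq hfin]; exact h.active
  local_step := hstep
  called_sub := h.called_sub
  comp_eq := h.comp_eq
  caller_eq := h.caller_eq
  base_eq := h.base_eq
  updated := by rw [← sameLoc_eq hfin]; exact h.updated
  unchanged := by rw [← sameLoc_eq hfin]; exact h.unchanged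
  created := hinit ▸ h.created
  calls_eq := h.calls_eq

/-- All instances in `G'` that are not in `called` are initialised children of instances in `C`. -/
def NewInstances (A : System sig U) (called C : Finset ℕ) (G' : Config sig U) : Prop :=
  ∀ c ∈ G'.called \ called, ∃ q ∈ C, ∃ k, G'.caller c = some (q, k) ∧
    G'.comp c = k.callee ∧ ChildState (G'.st q) k (G'.st c) ∧ G'.st c ∈ A.init k.callee

/-- `G'` results from `G` by adding instances. -/
structure Extends (G G' : Config sig U) : Prop where
  called_sub : G.called ⊆ G'.called
  comp_eq : ∀ a ∈ G.called, G'.comp a = G.comp a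
  caller_eq : ∀ a ∈ G.called, G'.caller a = G.caller a
  st_eq : ∀ a ∈ G.called, G'.st a = G.st a

theorem Extends.refl (G : Config sig U) : G.Extends G :=
  ⟨subset_rfl, fun _ _ => rfl, fun _ _ => rfl, fun _ _ => rfl⟩

theorem Extends.trans {G₁ G₂ G₃ : Config sig U} (h : G₁.Extends G₂) (h' : G₂.Extends G₃) :
    G₁.Extends G₃ :=
  ⟨h.1.trans h'.1, fun a ha => (h'.2 a (h.1 ha)).trans (h.2 a ha),
    fun a ha => (h'.3 a (h.1 ha)).trans (h.3 a ha), fun a ha => (h'.4 a (h.1 ha)).trans (h.4 a ha)⟩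

theorem exists_of_mem_callsOf {G : Config sig U} {new : Finset ℕ} {q : ℕ} {k : Call sig U}
    (h : k ∈ G.callsOf new q) : ∃ c ∈ new, G.caller c = some (q, k) := by
  obtain ⟨c, hc, e⟩ := (Multiset.mem_filterMap _ _).1 h
  refine ⟨c, hc, ?_⟩
  obtain ⟨⟨p, k'⟩, e₁, e₂⟩ := Option.bind_eq_some_iff.1 e
  simp only at e₂
  split_ifs at e₂ with hp
  simp only [Option.some.injEq] at e₂
  rw [e₁, hp, e₂]

/-- An instance that has been called can be duplicated. -/
theorem exists_extends_duplicate {A : System sig U} {called C : Finset ℕ} {G : Config sig U}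
    (hsub : called ⊆ G.called) (hC : C ⊆ called) (hG : NewInstances A called C G) {q : ℕ}
    {k : Call sig U} (hk : k ∈ G.callsOf (G.called \ called) q) :
    ∃ G' : Config sig U, G.Extends G' ∧ NewInstances A called C G' ∧
      G'.callsOf (G'.called \ called) q = k ::ₘ G.callsOf (G.called \ called) q ∧
      ∀ p ≠ q, G'.callsOf (G'.called \ called) p = G.callsOf (G.called \ called) p := by
  classical
  obtain ⟨c, hc, hcq⟩ := exists_of_mem_callsOf hk
  obtain ⟨d, hd⟩ := Infinite.exists_notMem_finset G.called
  have hne : ∀ a ∈ G.called, a ≠ d := fun a ha e => hd (e ▸ ha)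
  let G' : Config sig U :=
    { called := insert d G.called
      comp := Function.update G.comp d (G.comp c)
      caller := Function.update G.caller d (G.caller c)
      st := Function.update G.st d (G.st c) }
  have hext : G.Extends G' := ⟨Finset.subset_insert _ _,
    fun a ha => Function.update_of_ne (hne a ha) _ _,
    fun a ha => Function.update_of_ne (hne a ha) _ _,
    fun a ha => Function.update_of_ne (hne a ha) _ _⟩
  have hnew : G'.called \ called = insert d (G.called \ called) :=
    Finset.insert_sdiff_of_notMem _ fun h => hd (hsub h)
  have hd' : d ∉ G.called \ called := fun h => hd (Finset.mem_sdiff.1 h).1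
  have hcalls : ∀ p, G'.callsOf (G'.called \ called) p =
      (if q = p then {k} else 0) + G.callsOf (G.called \ called) p := by
    intro p
    rw [hnew, callsOf, Finset.insert_val_of_notMem hd']
    have e : ∀ s : Finset ℕ, s ⊆ G.called → G'.callsOf s p = G.callsOf s p := by
      intro s hs
      unfold callsOf
      have hs' : ∀ a ∈ s.val, G'.caller a = G.caller a := fun a ha => hext.caller_eq a (hs ha)
      generalize s.val = t at hs'
      induction t using Quot.inductionOn with
      | _ l => exact congrArg _ (List.filterMap_congr fun a ha => by rw [hs' a ha])
    have ed : G'.caller d = some (q, k) := (Function.update_self _ _ _).trans hcq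
    rw [← e _ Finset.sdiff_subset, callsOf]
    split_ifs with hp
    · rw [Multiset.filterMap_cons_some _ _ _ (b := k) (by simp [ed, hp])]
      rfl
    · rw [Multiset.filterMap_cons_none _ _ (by simp [ed, hp]), zero_add]
  refine ⟨G', hext, fun a ha => ?_, by simp [hcalls], fun p hp => by simp [hcalls, hp.symm]⟩
  -- The callers are old instances with unchanged local states, so the copy is initialised
  -- correctly, just as the original is.
  have hCG : ∀ p ∈ C, G'.st p = G.st p := fun p hp => hext.st_eq p (hsub (hC hp))
  rw [hnew, Finset.mem_insert] at ha
  rcases ha with rfl | ha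
  · obtain ⟨p, hp, k', h₁, h₂, h₃, h₄⟩ := hG c hc
    refine ⟨p, hp, k', ?_⟩
    rw [hCG p hp, show G'.caller a = _ from Function.update_self _ _ _,
      show G'.comp a = _ from Function.update_self _ _ _,
      show G'.st a = _ from Function.update_self _ _ _]
    exact ⟨h₁, h₂, h₃, h₄⟩
  · have ha' := (Finset.mem_sdiff.1 ha).1
    obtain ⟨p, hp, k', h₁, h₂, h₃, h₄⟩ := hG a ha
    refine ⟨p, hp, k', ?_⟩
    rw [hCG p hp, hext.caller_eq a ha', hext.comp_eq a ha', hext.st_eq a ha']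
    exact ⟨h₁, h₂, h₃, h₄⟩

/-- By `hmem` every required call already occurs, so only multiplicities are missing; duplication
supplies them one at a time. The induction is on the total number of missing calls. -/
theorem exists_extends_callsOf_eq {A : System sig U} {called C : Finset ℕ} (hC : C ⊆ called)
    {K : ℕ → Multiset (Call sig U)} {G : Config sig U} (hsub : called ⊆ G.called)
    (hG : NewInstances A called C G)
    (hle : ∀ q ∈ C, G.callsOf (G.called \ called) q ≤ K q)
    (hmem : ∀ q ∈ C, ∀ k ∈ K q, k ∈ G.callsOf (G.called \ called) q) :
    ∃ G' : Config sig U, G.Extends G' ∧ NewInstances A called C G' ∧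
      ∀ q ∈ C, G'.callsOf (G'.called \ called) q = K q := by
  induction hn : ∑ q ∈ C, ((K q).card - (G.callsOf (G.called \ called) q).card)
    using Nat.strong_induction_on generalizing G with
  | _ n ih =>
  by_cases hall : ∀ q ∈ C, G.callsOf (G.called \ called) q = K q
  · exact ⟨G, .refl G, hG, hall⟩
  push Not at hall
  obtain ⟨q, hq, hne⟩ := hall
  obtain ⟨k, hk⟩ := Multiset.lt_iff_cons_le.1 (lt_of_le_of_ne (hle q hq) hne)
  obtain ⟨G', h₁, h₂, h₃, h₄⟩ := exists_extends_duplicate hsub hC hG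
    (hmem q hq k (Multiset.mem_of_le hk (Multiset.mem_cons_self _ _)))
  have hle' : ∀ p ∈ C, G'.callsOf (G'.called \ called) p ≤ K p := by
    intro p hp
    by_cases e : p = q
    · rw [e, h₃]; exact hk
    · rw [h₄ p e]; exact hle p hp
  have hge : ∀ p, G.callsOf (G.called \ called) p ≤ G'.callsOf (G'.called \ called) p := by
    intro p
    by_cases e : p = q
    · rw [e, h₃]; exact Multiset.le_cons_self _ _
    · rw [h₄ p e]
  obtain ⟨G'', g₁, g₂, g₃⟩ := ih _ (by
    rw [← hn]
    refine Finset.sum_lt_sum (fun p _ => Nat.sub_le_sub_left (Multiset.card_le_card (hge p)) _)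
      ⟨q, hq, ?_⟩
    have := Multiset.card_le_card hk
    rw [h₃]
    rw [Multiset.card_cons] at this ⊢
    omega) (hsub.trans h₁.called_sub) h₂ hle'
    (fun p hp k hk => Multiset.mem_of_le (hge p) (hmem p hp k hk)) rfl
  exact ⟨G'', h₁.trans g₁, g₂, g₃⟩

/-- A step can be completed to a step with the full number of calls. -/
theorem Step.exists_extends {A B : System sig U} (hfin : ∀ i S, A.Final i S ↔ B.Final i S)
    (hinit : A.init = B.init) {G G' : Config sig U} {C : Finset ℕ} {T : ℕ → State V U}
    {K K' : ℕ → Multiset (Call sig U)} (h : G.Step A C T K' G')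
    (hstep : ∀ q ∈ C, B.step (G.comp q) (G.st q) (K q) (T q)) (hle : ∀ q ∈ C, K' q ≤ K q)
    (hmem : ∀ q ∈ C, ∀ k ∈ K q, k ∈ K' q) :
    ∃ G'' : Config sig U, G'.Extends G'' ∧ NewInstances A G.called C G'' ∧ G.Step B C T K G'' := by
  obtain ⟨G'', h₁, h₂, h₃⟩ := exists_extends_callsOf_eq (A := A) (K := K)
    (fun q hq => (h.active q hq).1.1) h.called_sub h.created
    (fun q hq => (h.calls_eq q hq).symm ▸ hle q hq) (fun q hq => (h.calls_eq q hq).symm ▸ hmem q hq)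
  refine ⟨G'', h₁, h₂, ?_⟩
  have e : ∀ {a}, a ∈ G.called → a ∈ G'.called := fun ha => h.called_sub ha
  exact {
    active := by rw [← active_eq hfin, ← waiting_eq hfin]; exact h.active
    local_step := hstep
    called_sub := h.called_sub.trans h₁.called_sub
    comp_eq := fun a ha => (h₁.comp_eq a (e ha)).trans (h.comp_eq a ha)
    caller_eq := fun a ha => (h₁.caller_eq a (e ha)).trans (h.caller_eq a ha)
    base_eq := fun a ha => by rw [h₁.st_eq a (e ha), h.base_eq a ha]
    -- Sharing is evaluated in `G`, before the step, so the added duplicates do not affect it.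
    updated := fun a ha => by rw [← sameLoc_eq hfin, h₁.st_eq a (e ha)]; exact h.updated a ha
    unchanged := fun a ha => by rw [← sameLoc_eq hfin, h₁.st_eq a (e ha)]; exact h.unchanged a ha
    created := hinit ▸ h₂
    calls_eq := h₃ }

end Config

/-! ### Runs and side conditions under capping of calls -/

namespace System
open Config
variable {A B : System sig U}

/-- If `B` makes at most `m` calls in the steps of its runs, then capping the calls does not change
the runs. -/
theorem Caps.isRun_iff {m : ℕ} (h : Caps m A B) (hsub : ∀ i, B.init i ⊆ B.states i)
    (hm : ∀ N G C, B.IsRun N G C → ∀ j : ℕ, (j : ℕ∞) < N →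
      ∀ T K, (G j).Step B (C j) T K (G (j + 1)) → ∀ q ∈ C j, (K q).card ≤ m)
    (N : ℕ∞) (G : ℕ → Config sig U) (C : ℕ → Finset ℕ) : A.IsRun N G C ↔ B.IsRun N G C := by
  have hfin := h.final_iff
  constructor
  · intro hA
    refine ⟨?_, h.states_eq ▸ hA.state, fun j => ?_⟩
    · obtain ⟨a₀, h₁, h₂, h₃, h₄, h₅⟩ := hA.start
      exact ⟨a₀, h₁, h₂.trans h.main_eq, h₃, by rw [← h.init_eq, ← h.main_eq]; exact h₄, h₅⟩
    -- The bound on calls needs a whole run of `B`, so all earlier steps must already be known to be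
    -- steps of `B`.
    induction j using Nat.strong_induction_on with
    | _ j ih =>
    intro hj
    obtain ⟨T, K', hstep⟩ := hA.step j hj
    have hK : ∀ q ∈ C j, ∃ K, B.step ((G j).comp q) ((G j).st q) K (T q) ∧ K' q = cap m K := by
      intro q hq
      rcases h.step_cases _ _ _ _ (hstep.local_step q hq) with hK | ⟨hn, -, -⟩
      · exact hK
      · have hact := hstep.active q hq
        exact absurd ((hfin _ _).2 fun K S' hs => (hn K S' hs).elim)
          (not_final_of_active hact.1 hact.2)
    choose! K hK₁ hK₂ using hK
    obtain ⟨G'', h₁, h₂, h₃⟩ := hstep.exists_extends hfin h.init_eq hK₁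
      (fun q hq => hK₂ q hq ▸ cap_le _ _) (fun q hq k hk => by rw [hK₂ q hq]; exact mem_cap.2 hk)
    -- The given run up to `j`, followed by the completed global state. This run of `B` only serves
    -- to show that `K q` has at most `m` elements, so that the original step needs no completion.
    have hrun : B.IsRun ((j + 1 : ℕ) : ℕ∞) (fun n => if n ≤ j then G n else G'') C := by
      refine ⟨?_, fun n hn a ha => ?_, fun n hn => ?_⟩
      · obtain ⟨a₀, h₁, h₂, h₃, h₄, h₅⟩ := hA.start
        simp only [Nat.zero_le, if_true]
        exact ⟨a₀, h₁, h₂.trans h.main_eq, h₃, by rw [← h.init_eq, ← h.main_eq]; exact h₄, h₅⟩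
      · have hn' : n ≤ j + 1 := by exact_mod_cast hn
        have hle : ∀ n' : ℕ, n' ≤ j + 1 → (n' : ℕ∞) ≤ N := fun n' hn' =>
          le_trans (by exact_mod_cast hn') (Order.add_one_le_of_lt hj)
        split_ifs at ha ⊢ with hnj
        · exact h.states_eq ▸ hA.state n (hle n hn') a ha
        · by_cases hold : a ∈ (G (j + 1)).called
          · rw [h₁.st_eq a hold, h₁.comp_eq a hold, ← h.states_eq]
            exact hA.state _ (hle _ le_rfl) a hold
          · obtain ⟨q, -, k, -, e, -, hi⟩ := h₂ a
              (Finset.mem_sdiff.2 ⟨ha, fun hh => hold (hstep.called_sub hh)⟩)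
            rw [e]
            exact hsub _ (h.init_eq ▸ hi)
      · have hn' : n < j + 1 := by exact_mod_cast hn
        by_cases e : n = j
        · subst e
          simp only [le_refl, if_true, show ¬ n + 1 ≤ n by omega, if_false]
          exact ⟨T, K, h₃⟩
        · simp only [show n ≤ j by omega, show n + 1 ≤ j by omega, if_true]
          exact ih n (by omega) (lt_trans (by exact_mod_cast (by omega : n < j)) hj)
    have hcard : ∀ q ∈ C j, (K q).card ≤ m :=
      hm _ _ _ hrun j (by exact_mod_cast Nat.lt_succ_self j) T K (by simpa using h₃)
    refine ⟨T, K', hstep.transfer hfin h.init_eq fun q hq => ?_⟩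
    rw [hK₂ q hq, cap_eq_self (hcard q hq)]
    exact hK₁ q hq
  · intro hB
    refine ⟨?_, h.states_eq ▸ hB.state, fun j hj => ?_⟩
    · obtain ⟨a₀, h₁, h₂, h₃, h₄, h₅⟩ := hB.start
      exact ⟨a₀, h₁, h₂.trans h.main_eq.symm, h₃, by rw [h.init_eq, h.main_eq]; exact h₄, h₅⟩
    · obtain ⟨T, K, hstep⟩ := hB.step j hj
      refine ⟨T, K, hstep.transfer (fun i S => (hfin i S).symm) h.init_eq.symm fun q hq => ?_⟩
      rw [← cap_eq_self (hm N G C hB j hj T K hstep q hq)]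
      exact h.of_step _ _ _ _ (hstep.local_step q hq)

theorem Caps.updates {m : ℕ} (h : Caps m A B) {i : ι} {f : V.Sym} (hA : A.Updates i f) :
    B.Updates i f := by
  obtain ⟨S, K, S', a, v, hs, hd⟩ := hA
  rcases h.step_cases i S K S' hs with ⟨K', h₁, -⟩ | ⟨-, -, rfl⟩
  · exact ⟨S, K', S', a, v, h₁, hd⟩
  · exact absurd hd.1 hd.2

theorem Caps.ioAssumption {m : ℕ} (h : Caps m A B) {reads reads' : ι → Set V.Sym}
    (hr : ∀ i, reads i ⊆ reads' i) (hB : B.IOAssumption reads') : A.IOAssumption reads where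
  inp_not_updated i f hf hu := hB.inp_not_updated i f hf (h.updates hu)
  out_not_read i f hf hu := hB.out_not_read i f hf (hr i hu)
  init_undef := h.init_eq ▸ hB.init_undef

/-- The conditions on single calls survive because capping keeps the same calls, and the condition
on pairs because `cap m K ≤ K`. Idle steps make no calls. -/
theorem Caps.callStep {m : ℕ} (h : Caps m A B) {reads reads' : ι → Set V.Sym}
    (hr : ∀ i, reads i ⊆ reads' i) (hB : B.CallStep reads') : A.CallStep reads where
  relationship i S K S' hs k hk := by
    rcases h.step_cases i S K S' hs with ⟨K', h₁, rfl⟩ | ⟨-, rfl, -⟩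
    · have hR := hB.relationship i S K' S' h₁ k (mem_cap.1 hk)
      exact ⟨hR.wellFormed, fun f r e hf => hR.inp_not_read f r e (hr i hf),
        fun f hu => hR.out_not_updated f (h.updates hu)⟩
    · simp at hk
  items_mem i S K S' hs k hk := by
    rcases h.step_cases i S K S' hs with ⟨K', h₁, rfl⟩ | ⟨-, rfl, -⟩
    · exact hB.items_mem i S K' S' h₁ k (mem_cap.1 hk)
    · simp at hk
  independent i S K S' hs k₁ k₂ hk := by
    rcases h.step_cases i S K S' hs with ⟨K', h₁, rfl⟩ | ⟨-, rfl, -⟩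
    · exact hB.independent i S K' S' h₁ k₁ k₂ (hk.trans (cap_le _ _))
    · simp at hk
  initialized i S K S' hs k hk := by
    rcases h.step_cases i S K S' hs with ⟨K', h₁, rfl⟩ | ⟨-, rfl, -⟩
    · exact h.init_eq ▸ hB.initialized i S K' S' h₁ k (mem_cap.1 hk)
    · simp at hk

end System

namespace SeqRecAlgorithm
variable (R : SeqRecAlgorithm sig U)

/-- The update sets yielded are empty or of the form `S.diff S'` for a step to `S'`, so they are
consistent and lead to exactly the intended successor. -/
theorem caps_ruleSystem (m : ℕ) (rule : ι → Rule sig 0)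
    (h : ∀ i, ∀ S ∈ R.states i, (R.deltas i S = ∅ ∧ (rule i).deltas S Fin.elim0 = {(∅, 0)}) ∨
      (rule i).deltas S Fin.elim0 = (fun d => (d.1, cap m d.2)) '' R.deltas i S) :
    System.Caps m (ruleSystem R.main rule R.states R.init) R.toSystem where
  main_eq := rfl
  states_eq := rfl
  init_eq := rfl
  of_step i S K S' hs := by
    have hS := (R.branchingTime.step_sub i S K S' hs).1
    have hd : (S.diff S', K) ∈ R.deltas i S := ⟨S', hs, rfl⟩
    refine ⟨hS, S.diff S', ?_,
      (State.applies_diff_iff (R.abstractState.base_eq i S K S' hs)).2 rfl⟩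
    rcases h i S hS with ⟨h₁, -⟩ | h₁
    · simp [h₁] at hd
    · rw [h₁]
      exact ⟨_, hd, rfl⟩
  step_cases i S K S' := by
    rintro ⟨hS, Δ, hΔ, ha⟩
    rcases h i S hS with ⟨h₁, h₂⟩ | h₂
    · rw [h₂, Set.mem_singleton_iff, Prod.mk.injEq] at hΔ
      obtain ⟨rfl, rfl⟩ := hΔ
      refine Or.inr ⟨fun K' S'' hs => ?_, rfl, State.applies_empty_iff.1 ha⟩
      have hd : (S.diff S'', K') ∈ R.deltas i S := ⟨S'', hs, rfl⟩
      simp [h₁] at hd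
    · rw [h₂] at hΔ
      obtain ⟨⟨_, K'⟩, ⟨S'', hs, rfl⟩, e⟩ := hΔ
      simp only [Prod.mk.injEq] at hs e
      obtain ⟨rfl, rfl⟩ := e
      rw [(State.applies_diff_iff (R.abstractState.base_eq i S K' S'' hs)).1 ha]
      exact Or.inl ⟨K', hs, rfl⟩

end SeqRecAlgorithm

end

end RecursiveASM

theorem mainTheorem1 {V : RecursiveASM.Vocabulary} {U : Type*} [RecursiveASM.LogicalConstants U]
    [Infinite U] {ι : Type*} [Finite ι] {sig : ι → RecursiveASM.IOSig V}
    (R : RecursiveASM.SeqRecAlgorithm sig U) :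
    ∃ M : RecursiveASM.RecASM sig U, M.toSystem.RunEquivalent R.toSystem := by
  obtain ⟨m, -, hm⟩ := R.boundedBranching
  choose rule h₁ h₂ h₃ using R.exists_rule m
  have hcaps := R.caps_ruleSystem m rule h₃
  refine ⟨{
    main := R.main
    rule := rule
    states := R.states
    init := R.init
    rule_over := h₁
    states_over := R.abstractState.states_over
    states_iso := R.abstractState.states_iso
    states_step := fun i S Δ K S' hS hΔ ha => ?_
    init_sub := R.branchingTime.init_sub
    init_iso := R.abstractState.init_iso
    ioAssumption := hcaps.ioAssumption h₂ R.ioAssumption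
    callStep := hcaps.callStep h₂ R.callStep }, rfl, rfl, rfl,
    hcaps.isRun_iff R.branchingTime.init_sub hm⟩
  -- A step of the rule is a step of `R` up to the number of calls, or idle; neither leaves the
  -- class of states.
  rcases hcaps.step_cases i S K S' ⟨hS, Δ, hΔ, ha⟩ with ⟨K', hs, -⟩ | ⟨-, -, rfl⟩
  · exact (R.branchingTime.step_sub i S K' S' hs).2
  · exact hS
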